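/- Let $\alpha,\sigma_R^2,\sigma_D^2,P_S,P_R>0$ and consider the (normalized) two-hop full-duplex relay channel with residual self-interference $$Y_R=X_S+I+N_R,\qquad Y_D=X_R+N_D,$$ where $N_R\sim\mathcal N(0,\sigma_R^2)$ and $N_D\sim\mathcal N(0,\sigma_D^2)$ are independent noises and, given $X_R=x_R$, $I\sim\mathcal N(0,\alpha x_R^2)$ independently of everything else ($I=G X_R$ with $G\sim\mathcal N(0,\alpha)$). All symbol intervals are independent and rates are in bits. Let $$C=\sup_{p(x_R)}\min\Big\{\sup_{p(x_S|x_R)} I(X_S;Y_R|X_R),\ I(X_R;Y_D)\Big\}\quad\text{subject to } E\{X_S^2\}\le P_S,\ E\{X_R^2\}\le P_R ,$$ and let $p^*$ be a law of $X_R$ that attains this supremum. Let $x_{\rm th}>0$ be such that $E_{p^*}\{P_S(X_R)\}=P_S$, where $P_S(x_R)=\alpha\max\{0,x_{\rm th}^2-x_R^2\}$, and let $p_T=\Pr_{p^*}\{|X_R|<x_{\rm th}\}$. Let $R=C-\epsilon$ with $\epsilon>0$. The source's codebook maps each binary sequence of $\lceil kR\rceil$ bits (of $0$ bits if $R\le 0$)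 to a codeword of $n=\lfloor kp_T\rfloor$ symbols; all symbols of all codewords are independent and $\mathcal N(0,1)$. In the first time slot, of $k$ symbol intervals, a uniformly distributed message is mapped to its codeword $\mathbf x_S(1)$, the source sends each symbol of it amplified by $\sqrt{P_S(0)}=\sqrt{\alpha}\,x_{\rm th}$ in the first $n$ intervals, and the relay is silent ($X_R=0$ in all $k$ intervals). The relay forms $\mathbf y_R(1)$ from the first $n$ received symbols and uses the jointly $\delta$-typical decoder: it outputs the message whose codeword is jointly $\delta$-typical with $\mathbf y_R(1)$ if there is exactly one, and otherwise declares an error. Joint $\delta$-typicality of $(\mathbf x,\mathbf y)$ means that the three normalized negative logarithms $-\frac1n\log_2 f_X(\mathbf x)$, $-\frac1n\log_2 f_Y(\mathbf y)$, $-\frac1n\log_2 f_{XY}(\mathbf x,\mathbf y)$ of the product densities differ by less than $\delta$ from the differential entropies $h(X),h(Y),h(X,Y)$, where $X\sim\mathcal N(0,1)$ and $Y=\sqrt{P_S(0)}\,X+N_R$ with $N_R$ independent of $X$. Then $C<\infty$, $$R<\max_{p(x_S|x_R=0)} I(X_S;Y_R|X_R=0)\,p_T=\frac12\log_2\Big(1+\frac{\alpha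 x_{\rm th}^2}{\sigma_R^2}\Big)p_T ,$$ where the maximum is over all laws of $X_S$ with $E\{X_S^2\}\le P_S(0)$ and is attained, and the codeword $\mathbf x_S(1)$ is decoded successfully by the relay: there is $\delta_0>0$ such that for every $0<\delta<\delta_0$ the probability (over codebook, message, interference and noise) that the decoder does not output the sent message tends to $0$ as $k\to\infty$. -/

import Mathlib

open MeasureTheory ProbabilityTheory InformationTheory Filter Topology
open scoped ENNReal NNReal

noncomputable section

/-! ### Mutual informations and the capacity

Everything refers to the normalized two-hop full-duplex relay channel
`Y_R = X_S + G * X_R + N_R`, `Y_D = X_R + N_D`, with independent `G ∼ N(0, α)` (normalized random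
self-interference gain), `N_R ∼ N(0, σR2)`, `N_D ∼ N(0, σD2)`. Given `X_R = x`, the residual
self-interference `I = G * x` is `N(0, α x²)`. All informations are in bits. -/

/-- Mutual information, in bits, of a pair of random variables with joint law `ρ`. -/
def mutualInfoBits {A B : Type*} [MeasurableSpace A] [MeasurableSpace B]
    (ρ : Measure (A × B)) : ℝ≥0∞ :=
  klDiv ρ ((ρ.map Prod.fst).prod (ρ.map Prod.snd)) / ENNReal.ofReal (Real.log 2)

/-- Joint law of `(X_S, Y_R)` given `X_R = x`, when `X_S` has law `p` given `X_R = x`. -/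
def sourceRelayLaw (α σR2 : ℝ≥0) (x : ℝ) (p : Measure ℝ) : Measure (ℝ × ℝ) :=
  (p.prod ((gaussianReal 0 α).prod (gaussianReal 0 σR2))).map
    (fun t => (t.1, t.1 + t.2.1 * x + t.2.2))

/-- `I(X_S; Y_R | X_R = x)` when `X_S` has law `p` given `X_R = x`. -/
def sourceRelayInfoAt (α σR2 : ℝ≥0) (x : ℝ) (p : Measure ℝ) : ℝ≥0∞ :=
  mutualInfoBits (sourceRelayLaw α σR2 x p)

/-- `max I(X_S; Y_R | X_R)` over all conditional laws `κ = p(x_S | x_R)` with `E[X_S²] ≤ P_S`,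
when `X_R` has law `ν`. -/
def sourceRelayRate (α σR2 PS : ℝ≥0) (ν : Measure ℝ) : ℝ≥0∞ :=
  ⨆ (κ : Kernel ℝ ℝ) (_ : IsMarkovKernel κ)
    (_ : ∫⁻ x, ∫⁻ s, ENNReal.ofReal (s ^ 2) ∂(κ x) ∂ν ≤ (PS : ℝ≥0∞)),
    ∫⁻ x, sourceRelayInfoAt α σR2 x (κ x) ∂ν

/-- `I(X_R; Y_D)` when `X_R` has law `ν`. -/
def relayDestInfo (σD2 : ℝ≥0) (ν : Measure ℝ) : ℝ≥0∞ :=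
  mutualInfoBits ((ν.prod (gaussianReal 0 σD2)).map (fun t => (t.1, t.1 + t.2)))

/-- The capacity: the supremum of `min {max I(X_S; Y_R | X_R), I(X_R; Y_D)}` over all laws `ν` of
`X_R` with `E[X_R²] ≤ P_R`. -/
def relayCapacity (α σR2 σD2 PS PR : ℝ≥0) : ℝ≥0∞ :=
  ⨆ (ν : Measure ℝ) (_ : IsProbabilityMeasure ν)
    (_ : ∫⁻ x, ENNReal.ofReal (x ^ 2) ∂ν ≤ (PR : ℝ≥0∞)),
    min (sourceRelayRate α σR2 PS ν) (relayDestInfo σD2 ν)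

/-- `ν` is an optimal input distribution at the relay. -/
def IsOptimalRelayInput (α σR2 σD2 PS PR : ℝ≥0) (ν : Measure ℝ) : Prop :=
  ∫⁻ x, ENNReal.ofReal (x ^ 2) ∂ν ≤ (PR : ℝ≥0∞) ∧
    min (sourceRelayRate α σR2 PS ν) (relayDestInfo σD2 ν) = relayCapacity α σR2 σD2 PS PR

/-- The source's power allocation `P_S(x_R) = α max {0, x_th² - x_R²}`. -/
def sourcePower (α : ℝ≥0) (xth x : ℝ) : ℝ := α * max 0 (xth ^ 2 - x ^ 2)

/-- `p_T = Pr {|X_R| < x_th}` when `X_R` has law `ν`. -/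
def transmitProb (ν : Measure ℝ) (xth : ℝ) : ℝ := ν.real {x | |x| < xth}

/-- The number `⌊k p_T⌋` of symbols in a codeword of the source. -/
def blockLength (ν : Measure ℝ) (xth : ℝ) (k : ℕ) : ℕ := ⌊(k : ℝ) * transmitProb ν xth⌋₊

lemma blockLength_le (ν : Measure ℝ) [IsProbabilityMeasure ν] (xth : ℝ) (k : ℕ) :
    blockLength ν xth k ≤ k := by
  refine Nat.floor_le_of_le ?_
  exact mul_le_of_le_one_right (Nat.cast_nonneg k) measureReal_le_one

/-! ### Joint typicality with respect to a joint density -/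

/-- First marginal of the joint density `f`. -/
def margFst (f : ℝ → ℝ → ℝ) (x : ℝ) : ℝ := ∫ y, f x y

/-- Second marginal of the joint density `f`. -/
def margSnd (f : ℝ → ℝ → ℝ) (y : ℝ) : ℝ := ∫ x, f x y

/-- Differential entropy, in bits, of the density `g` with respect to Lebesgue measure. -/
def diffEntropyBits {E : Type*} [MeasureSpace E] (g : E → ℝ) : ℝ :=
  -∫ z, g z * Real.logb 2 (g z)

/-- `(x, y) ∈ ℝⁿ × ℝⁿ` is jointly `δ`-typical for the joint density `f`: the three empirical
entropies are `δ`-close to the differential entropies `h(X)`, `h(Y)` and `h(X, Y)`. -/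
def JointlyTypical (f : ℝ → ℝ → ℝ) (δ : ℝ) {n : ℕ} (x y : Fin n → ℝ) : Prop :=
  |-(1 / (n : ℝ)) * Real.logb 2 (∏ i, margFst f (x i)) - diffEntropyBits (margFst f)| < δ ∧
  |-(1 / (n : ℝ)) * Real.logb 2 (∏ i, margSnd f (y i)) - diffEntropyBits (margSnd f)| < δ ∧
  |-(1 / (n : ℝ)) * Real.logb 2 (∏ i, f (x i) (y i))
      - diffEntropyBits (fun p : ℝ × ℝ => f p.1 p.2)| < δ

open Classical in
/-- The typical decoder: it outputs the message whose codeword is jointly typical with the received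
word `y`, if there is exactly one, and otherwise declares an error (`none`). -/
def typicalDecoder (f : ℝ → ℝ → ℝ) (δ : ℝ) {M : Type*} {n : ℕ} (c : M → Fin n → ℝ)
    (y : Fin n → ℝ) : Option M :=
  if h : ∃! w, JointlyTypical f δ (c w) y then some h.choose else none

/-! ### The first time slot -/

/-- The messages: binary sequences of `⌈k R⌉` bits. -/
abbrev Message (k : ℕ) (R : ℝ) : Type := Fin ⌈(k : ℝ) * R⌉₊ → Bool

/-- Law of the random codebook with message set `M` and codewords of length `n`: all symbols are
independent and `N(0, 1)`. -/
def codebookLaw (M : Type*) [Fintype M] (n : ℕ) : Measure (M → Fin n → ℝ) :=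
  Measure.pi fun _ => Measure.pi fun _ => gaussianReal 0 1

/-- Symbols sent by the source in the `k` intervals of the first slot: the codeword `x`, amplified
by `√P_S(0)`, and then silence. -/
def firstSlotSource (α : ℝ≥0) (xth : ℝ) (k : ℕ) {n : ℕ} (x : Fin n → ℝ) : Fin k → ℝ :=
  fun i => if h : (i : ℕ) < n then Real.sqrt (sourcePower α xth 0) * x ⟨i, h⟩ else 0

/-- Symbols sent by the relay in the first slot: it is silent. -/
def firstSlotRelay (k : ℕ) : Fin k → ℝ := fun _ => 0

/-- Symbols received at the relay when the source sends `xS`, the relay sends `xR`, the normalized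
self-interference gains are `g` and the noise is `z`. -/
def relayReceived {k : ℕ} (xS xR g z : Fin k → ℝ) : Fin k → ℝ :=
  fun i => xS i + g i * xR i + z i

/-- Joint density, in one interval of the first slot, of the codeword symbol `X ∼ N(0, 1)` and
the received symbol, which is `N(√P_S(0) x, σR2)` given `X = x`. -/
def firstSlotDensity (α σR2 : ℝ≥0) (xth : ℝ) (x y : ℝ) : ℝ :=
  gaussianPDFReal 0 1 x * gaussianPDFReal (Real.sqrt (sourcePower α xth 0) * x) σR2 y

/-- Law of the randomness of the first slot: random codebook, self-interference gains and noise
at the relay, all independent. -/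
def firstSlotLaw (α σR2 : ℝ≥0) (k n : ℕ) (M : Type*) [Fintype M] :
    Measure ((M → Fin n → ℝ) × (Fin k → ℝ) × (Fin k → ℝ)) :=
  (codebookLaw M n).prod ((Measure.pi fun _ => gaussianReal 0 α).prod
    (Measure.pi fun _ => gaussianReal 0 σR2))

/-- Event that message `w` is sent and the relay's typical decoder, applied to the first `n` of
the `k` received symbols, does not output `w`. -/
def firstSlotError (α σR2 : ℝ≥0) (xth δ : ℝ) {k n : ℕ} (hn : n ≤ k) {M : Type*} (w : M) :
    Set ((M → Fin n → ℝ) × (Fin k → ℝ) × (Fin k → ℝ)) :=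
  {ω | typicalDecoder (firstSlotDensity α σR2 xth) δ ω.1
      (fun j => relayReceived (firstSlotSource α xth k (ω.1 w)) (firstSlotRelay k) ω.2.1 ω.2.2
        (Fin.castLE hn j)) ≠ some w}

/-- Error probability in the first slot, for a uniformly distributed message. -/
def firstSlotErrorProb (α σR2 : ℝ≥0) (xth δ : ℝ) {k n : ℕ} (hn : n ≤ k) (M : Type*)
    [Fintype M] : ℝ :=
  (∑ w : M, (firstSlotLaw α σR2 k n M).real (firstSlotError α σR2 xth δ hn w)) / Fintype.card M

end

/-!
Converse: given `X_R = x` the first hop is a Gaussian channel with noise variance `α x² + σR2`, so a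
Gaussian input is optimal there and the best rate is a concave function of the power spent at `x`.
Replacing that function by its tangent at the water level `α xth² + σR2` bounds the average
rate over the relay input; the powers `P_S(x)` reach this bound, and where they are positive their
rate is at most the one at `x = 0`. Hence the capacity is at most `p_T` times the rate at `x = 0`.

Achievability: the sent codeword is jointly typical with the output by the law of large numbers.
Given the output, the expectation of the likelihood ratio `f_XY / (f_X f_Y)` of an independent
codeword is `1`, while joint typicality makes the ratio at least `2 ^ (n (I - 3δ))`, so Markov's
inequality and a union bound over the messages control the wrong codewords.
-/

/-! ### Relative entropy -/

section RelativeEntropy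

variable {A B : Type*} [MeasurableSpace A] [MeasurableSpace B]

lemma klDiv_map_measurableEquiv (μ ν : Measure A) [IsFiniteMeasure μ] [IsFiniteMeasure ν]
    (e : A ≃ᵐ B) : klDiv (μ.map e) (ν.map e) = klDiv μ ν := by
  refine le_antisymm (klDiv_map_le μ ν e.measurable) ?_
  simpa only [Measure.map_map e.symm.measurable e.measurable, e.symm_comp_self, Measure.map_id]
    using klDiv_map_le (μ.map e) (ν.map e) e.symm.measurable

lemma klDiv_map_swap_prod (ρ : Measure (A × B)) [IsFiniteMeasure ρ] (p : Measure A) (q : Measure B)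
    [IsFiniteMeasure p] [IsFiniteMeasure q] :
    klDiv (ρ.map Prod.swap) (q.prod p) = klDiv ρ (p.prod q) := by
  rw [← Measure.prod_swap (μ := p) (ν := q)]
  exact klDiv_map_measurableEquiv ρ (p.prod q) MeasurableEquiv.prodComm

lemma klDiv_fst_prod_eq_add [StandardBorelSpace A] [Nonempty A] (ρ : Measure (A × B))
    [IsProbabilityMeasure ρ] (r : Measure B) [IsFiniteMeasure r] :
    klDiv ρ (ρ.fst.prod r) = klDiv ρ.snd r + klDiv ρ (ρ.fst.prod ρ.snd) := by
  rw [← klDiv_map_swap_prod ρ ρ.fst r, ← klDiv_map_swap_prod ρ ρ.fst ρ.snd]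
  have : IsProbabilityMeasure (ρ.map Prod.swap) :=
    Measure.isProbabilityMeasure_map measurable_swap.aemeasurable
  have h_disintegrate := (ρ.map Prod.swap).disintegrate (ρ.map Prod.swap).condKernel
  rw [Measure.fst_map_swap] at h_disintegrate
  rw [← h_disintegrate, ← Measure.compProd_const, ← Measure.compProd_const,
    klDiv_compProd_eq_add]

lemma mutualInfoBits_le_klDiv_fst_prod [StandardBorelSpace A] [Nonempty A] (ρ : Measure (A × B))
    [IsProbabilityMeasure ρ] (r : Measure B) [IsFiniteMeasure r] :
    mutualInfoBits ρ ≤ klDiv ρ (ρ.fst.prod r) / ENNReal.ofReal (Real.log 2) := by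
  rw [klDiv_fst_prod_eq_add]
  exact ENNReal.div_le_div_right le_add_self _

/-- The measure with density `f` with respect to `μ`, for a real-valued `f`: joint typicality is
stated with such densities. Negative values of `f` count as `0`. -/
noncomputable abbrev withRealDensity (μ : Measure A) (f : A → ℝ) : Measure A :=
  μ.withDensity fun a => ENNReal.ofReal (f a)

variable (μ : Measure A) {f g : A → ℝ}

lemma withRealDensity_absolutelyContinuous (hg : Measurable g) (hg0 : ∀ a, 0 < g a) :
    withRealDensity μ f ≪ withRealDensity μ g :=
  (withDensity_absolutelyContinuous _ _).trans <|
    withDensity_absolutelyContinuous' (by fun_prop) <|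
      ae_of_all _ fun a => (ENNReal.ofReal_pos.2 (hg0 a)).ne'

lemma llr_withRealDensity [SigmaFinite μ] (hf : Measurable f) (hg : Measurable g)
    (hf0 : ∀ a, 0 < f a) (hg0 : ∀ a, 0 < g a) :
    llr (withRealDensity μ f) (withRealDensity μ g)
      =ᵐ[μ] fun a => Real.log (f a) - Real.log (g a) := by
  have h_right := Measure.rnDeriv_withDensity_right (withRealDensity μ f) μ
    (f := fun a => ENNReal.ofReal (g a)) (by fun_prop)
    (ae_of_all _ fun a => (ENNReal.ofReal_pos.2 (hg0 a)).ne')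
    (ae_of_all _ fun a => ENNReal.ofReal_ne_top)
  have h_left := Measure.rnDeriv_withDensity μ (f := fun a => ENNReal.ofReal (f a)) (by fun_prop)
  filter_upwards [h_right, h_left] with a ha_right ha_left
  rw [llr, ha_right, ha_left, ENNReal.toReal_mul, ENNReal.toReal_inv,
    ENNReal.toReal_ofReal (hf0 a).le, ENNReal.toReal_ofReal (hg0 a).le,
    Real.log_mul (inv_ne_zero (hg0 a).ne') (hf0 a).ne', Real.log_inv]
  ring

lemma klDiv_withRealDensity [SigmaFinite μ] (hf : Measurable f) (hg : Measurable g)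
    (hf0 : ∀ a, 0 < f a) (hg0 : ∀ a, 0 < g a)
    [IsProbabilityMeasure (withRealDensity μ f)] [IsProbabilityMeasure (withRealDensity μ g)]
    (hint : Integrable (fun a => Real.log (f a) - Real.log (g a)) (withRealDensity μ f)) :
    klDiv (withRealDensity μ f) (withRealDensity μ g) =
      ENNReal.ofReal (∫ a, (Real.log (f a) - Real.log (g a)) ∂withRealDensity μ f) := by
  have hllr := (withDensity_absolutelyContinuous μ fun a => ENNReal.ofReal (f a)).ae_eq
    (llr_withRealDensity μ hf hg hf0 hg0)
  rw [klDiv_of_ac_of_integrable (withRealDensity_absolutelyContinuous μ hg hg0)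
      (hint.congr hllr.symm), integral_congr_ae hllr, probReal_univ, probReal_univ,
    add_sub_cancel_right]

end RelativeEntropy

/-! ### Additive Gaussian noise -/

lemma log_gaussianPDFReal (m : ℝ) {v : ℝ≥0} (hv : v ≠ 0) (x : ℝ) :
    Real.log (gaussianPDFReal m v x)
      = -(1 / 2 * Real.log (2 * Real.pi * v)) - (x - m) ^ 2 / (2 * v) := by
  have : (0 : ℝ) < v := by positivity
  rw [gaussianPDFReal, Real.log_mul (by positivity) (Real.exp_pos _).ne', Real.log_exp,
    Real.log_inv, Real.log_sqrt (by positivity)]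
  ring

lemma integral_sq_gaussianReal (v : ℝ≥0) : ∫ x, x ^ 2 ∂(gaussianReal 0 v) = v := by
  have h_variance := variance_fun_id_gaussianReal (μ := 0) (v := v)
  rw [variance_eq_integral (by fun_prop)] at h_variance
  simpa using h_variance

lemma lintegral_sq_gaussianReal (v : ℝ≥0) :
    ∫⁻ x, ENNReal.ofReal (x ^ 2) ∂(gaussianReal 0 v) = v := by
  rw [← ofReal_integral_eq_lintegral_ofReal
    (by simpa using (memLp_id_gaussianReal (μ := 0) (v := v) 2).integrable_sq)
    (ae_of_all _ fun x => sq_nonneg x), integral_sq_gaussianReal, ENNReal.ofReal_coe_nnreal]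

section AdditiveNoise

variable {A : Type*} [MeasurableSpace A] {φ : A → ℝ}

/-- Joint law of the input `X ∼ p` and the output `φ X + Z` of a channel with additive noise
`Z ∼ q` independent of `X`. The modulation `φ` covers amplification as well as the identity. -/
noncomputable def additiveNoiseLaw (φ : A → ℝ) (p : Measure A) (q : Measure ℝ) :
    Measure (A × ℝ) :=
  (p.prod q).map fun t => (t.1, φ t.1 + t.2)

lemma isProbabilityMeasure_additiveNoiseLaw (hφ : Measurable φ) (p : Measure A) (q : Measure ℝ)
    [IsProbabilityMeasure p] [IsProbabilityMeasure q] :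
    IsProbabilityMeasure (additiveNoiseLaw φ p q) :=
  Measure.isProbabilityMeasure_map (by fun_prop)

lemma fst_additiveNoiseLaw (hφ : Measurable φ) (p : Measure A) (q : Measure ℝ) [SFinite p]
    [IsProbabilityMeasure q] : (additiveNoiseLaw φ p q).fst = p := by
  rw [additiveNoiseLaw, Measure.fst_map_prodMk (by fun_prop)]
  exact Measure.fst_prod

lemma snd_additiveNoiseLaw (hφ : Measurable φ) (p : Measure A) (q : Measure ℝ) [SFinite p]
    [SFinite q] : (additiveNoiseLaw φ p q).snd = p.map φ ∗ q := by
  have h_prod : (p.map φ).prod q = (p.prod q).map (Prod.map φ id) := by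
    rw [← Measure.map_prod_map _ _ hφ measurable_id, Measure.map_id]
  rw [additiveNoiseLaw, Measure.snd_map_prodMk (by fun_prop), Measure.conv, h_prod,
    Measure.map_map (by fun_prop) (by fun_prop)]
  rfl

lemma additiveNoiseLaw_withRealDensity (hφ : Measurable φ) (p : Measure A) [SFinite p]
    {h : ℝ → ℝ} (hh : Measurable h) :
    additiveNoiseLaw φ p (withRealDensity volume h) =
      withRealDensity (p.prod volume) fun z => h (z.2 - φ z.1) := by
  refine Measure.ext_of_lintegral _ fun g hg => ?_
  rw [additiveNoiseLaw, lintegral_map hg (by fun_prop), lintegral_prod _ (by fun_prop),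
    lintegral_withDensity_eq_lintegral_mul _ (by fun_prop) hg, lintegral_prod _ (by fun_prop)]
  refine lintegral_congr fun x => ?_
  rw [lintegral_withDensity_eq_lintegral_mul _ (by fun_prop) (by fun_prop),
    ← lintegral_add_left_eq_self
      (fun y => ((fun z : A × ℝ => ENNReal.ofReal (h (z.2 - φ z.1))) * g) (x, y)) (φ x)]
  simp

lemma additiveNoiseLaw_gaussianReal (hφ : Measurable φ) (p : Measure A) [SFinite p] {v : ℝ≥0}
    (hv : v ≠ 0) :
    additiveNoiseLaw φ p (gaussianReal 0 v) =
      withRealDensity (p.prod volume) fun z => gaussianPDFReal (φ z.1) v z.2 := by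
  rw [gaussianReal_of_var_ne_zero _ hv]
  refine (additiveNoiseLaw_withRealDensity hφ p (measurable_gaussianPDFReal 0 v)).trans ?_
  simp_rw [gaussianPDFReal_sub, zero_add]

lemma measurable_gaussianPDFReal_comp (hφ : Measurable φ) (v : ℝ≥0) :
    Measurable fun z : A × ℝ => gaussianPDFReal (φ z.1) v z.2 := by
  unfold gaussianPDFReal
  fun_prop

lemma memLp_two_of_lintegral_sq_ne_top {p : Measure A} (hφ : Measurable φ)
    (h : ∫⁻ a, ENNReal.ofReal (φ a ^ 2) ∂p ≠ ∞) : MemLp φ 2 p := by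
  refine (memLp_two_iff_integrable_sq (by fun_prop)).2 ⟨by fun_prop, ?_⟩
  rw [hasFiniteIntegral_iff_ofReal (ae_of_all _ fun a => sq_nonneg (φ a))]
  exact h.lt_top

lemma integral_sq_le_of_lintegral_sq_le {p : Measure A} (hφ : Measurable φ) {P : ℝ≥0}
    (h : ∫⁻ a, ENNReal.ofReal (φ a ^ 2) ∂p ≤ P) : ∫ a, φ a ^ 2 ∂p ≤ P := by
  rw [integral_eq_lintegral_of_nonneg_ae (ae_of_all _ fun a => sq_nonneg (φ a)) (by fun_prop)]
  exact ENNReal.toReal_le_of_le_ofReal P.2 (by simpa using h)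

variable {p : Measure A} [IsProbabilityMeasure p]

lemma memLp_output_gaussianReal (hφ : MemLp φ 2 p) (v : ℝ≥0) :
    MemLp (fun t : A × ℝ => φ t.1 + t.2) 2 (p.prod (gaussianReal 0 v)) :=
  (hφ.comp_fst _).add ((memLp_id_gaussianReal (μ := 0) (v := v) 2).comp_snd _)

lemma integral_sq_output_gaussianReal (hφ : MemLp φ 2 p) (v : ℝ≥0) :
    ∫ t, (φ t.1 + t.2) ^ 2 ∂(p.prod (gaussianReal 0 v)) = ∫ a, φ a ^ 2 ∂p + v := by
  have h_input : MemLp (fun t : A × ℝ => φ t.1) 2 (p.prod (gaussianReal 0 v)) := hφ.comp_fst _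
  have h_noise : MemLp (fun t : A × ℝ => t.2) 2 (p.prod (gaussianReal 0 v)) :=
    (memLp_id_gaussianReal (μ := 0) (v := v) 2).comp_snd _
  have h_cross : Integrable (fun t : A × ℝ => φ t.1 * t.2) (p.prod (gaussianReal 0 v)) :=
    h_input.integrable_mul h_noise
  have h_cross_zero : ∫ t : A × ℝ, φ t.1 * t.2 ∂(p.prod (gaussianReal 0 v)) = 0 := by
    rw [integral_prod_mul φ fun z : ℝ => z, integral_id_gaussianReal, mul_zero]
  simp_rw [add_sq, mul_assoc]
  rw [integral_add (h_input.integrable_sq.fun_add (h_cross.const_mul 2)) h_noise.integrable_sq,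
    integral_add h_input.integrable_sq (h_cross.const_mul 2), integral_const_mul, h_cross_zero,
    integral_fun_fst (fun a => φ a ^ 2), integral_fun_snd (fun z : ℝ => z ^ 2),
    integral_sq_gaussianReal]
  simp

lemma log_gaussianPDFReal_sub_log_gaussianPDFReal (m : ℝ) {v t : ℝ≥0} (hv : v ≠ 0) (ht : t ≠ 0)
    (y : ℝ) :
    Real.log (gaussianPDFReal m v y) - Real.log (gaussianPDFReal 0 t y)
      = 1 / 2 * Real.log (t / v) - (y - m) ^ 2 / (2 * v) + y ^ 2 / (2 * t) := by
  have : (0 : ℝ) < v := by positivity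
  have : (0 : ℝ) < t := by positivity
  have h_log_mul {u : ℝ≥0} (hu : u ≠ 0) :
      Real.log (2 * Real.pi * u) = Real.log (2 * Real.pi) + Real.log u :=
    Real.log_mul (by positivity) (by exact_mod_cast hu)
  rw [log_gaussianPDFReal _ hv, log_gaussianPDFReal _ ht, h_log_mul hv, h_log_mul ht,
    Real.log_div (by positivity) (by positivity), sub_zero]
  ring

lemma integrable_and_integral_llr_additiveNoiseLaw (hφm : Measurable φ) (hφ : MemLp φ 2 p)
    {v t : ℝ≥0} (hv : v ≠ 0) (ht : t ≠ 0) :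
    Integrable (fun z => Real.log (gaussianPDFReal (φ z.1) v z.2)
        - Real.log (gaussianPDFReal 0 t z.2)) (additiveNoiseLaw φ p (gaussianReal 0 v)) ∧
      ∫ z, (Real.log (gaussianPDFReal (φ z.1) v z.2)
        - Real.log (gaussianPDFReal 0 t z.2)) ∂additiveNoiseLaw φ p (gaussianReal 0 v)
      = 1 / 2 * Real.log (t / v) - 1 / 2 + (∫ a, φ a ^ 2 ∂p + v) / (2 * t) := by
  simp_rw [log_gaussianPDFReal_sub_log_gaussianPDFReal _ hv ht]
  have h_noise : Integrable (fun s : A × ℝ => s.2 ^ 2 / (2 * v)) (p.prod (gaussianReal 0 v)) :=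
    (((memLp_id_gaussianReal (μ := 0) (v := v) 2).comp_snd p).integrable_sq).div_const _
  have h_output := (memLp_output_gaussianReal hφ v).integrable_sq.div_const (2 * t : ℝ)
  have h_difference : Integrable (fun s : A × ℝ => 1 / 2 * Real.log (t / v) - s.2 ^ 2 / (2 * v))
      (p.prod (gaussianReal 0 v)) := (integrable_const _).sub h_noise
  rw [additiveNoiseLaw, integrable_map_measure (by fun_prop) (by fun_prop),
    integral_map (by fun_prop) (by fun_prop)]
  simp only [Function.comp_def, add_sub_cancel_left]
  refine ⟨h_difference.add h_output, ?_⟩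
  rw [integral_add h_difference h_output,
    integral_sub (integrable_const _) h_noise, integral_div, integral_div,
    integral_sq_output_gaussianReal hφ, integral_fun_snd (fun z : ℝ => z ^ 2),
    integral_sq_gaussianReal]
  simp only [one_div, integral_const, probReal_univ, smul_eq_mul, one_mul, add_left_inj,
    sub_right_inj]
  field_simp

lemma klDiv_additiveNoiseLaw_gaussianReal (hφm : Measurable φ) (hφ : MemLp φ 2 p) {v t : ℝ≥0}
    (hv : v ≠ 0) (ht : t ≠ 0) :
    klDiv (additiveNoiseLaw φ p (gaussianReal 0 v)) (p.prod (gaussianReal 0 t)) =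
      ENNReal.ofReal (1 / 2 * Real.log (t / v) - 1 / 2 + (∫ a, φ a ^ 2 ∂p + v) / (2 * t)) := by
  have := isProbabilityMeasure_additiveNoiseLaw hφm p (gaussianReal 0 v)
  obtain ⟨h_integrable, h_integral⟩ := integrable_and_integral_llr_additiveNoiseLaw hφm hφ hv ht
  have h_product : p.prod (gaussianReal 0 t)
      = withRealDensity (p.prod volume) fun z => gaussianPDFReal 0 t z.2 := by
    rw [gaussianReal_of_var_ne_zero _ ht, prod_withDensity_right (measurable_gaussianPDF _ _)]
    rfl
  rw [← h_integral]
  rw [additiveNoiseLaw_gaussianReal hφm p hv] at this h_integrable ⊢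
  have : IsProbabilityMeasure (withRealDensity (p.prod volume)
      fun z : A × ℝ => gaussianPDFReal 0 t z.2) := h_product ▸ inferInstance
  rw [h_product]
  exact klDiv_withRealDensity _ (measurable_gaussianPDFReal_comp hφm v)
    (measurable_gaussianPDFReal_comp measurable_const t)
    (fun z => gaussianPDFReal_pos _ v z.2 hv) (fun z => gaussianPDFReal_pos 0 t z.2 ht)
    h_integrable

/-- Capacity, in bits per symbol, of the Gaussian channel with signal-to-noise ratio `r`. -/
noncomputable def awgnCapacity (r : ℝ) : ℝ := 1 / 2 * Real.logb 2 (1 + r)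

lemma awgnCapacity_eq_log_div (r : ℝ) :
    awgnCapacity r = 1 / 2 * Real.log (1 + r) / Real.log 2 := by
  rw [awgnCapacity, Real.logb, mul_div_assoc]

/-- The defect of the input power below `P` measures the loss against the Gaussian input. -/
lemma klDiv_additiveNoiseLaw_gaussianReal_div_log_two (hφm : Measurable φ) (hφ : MemLp φ 2 p)
    {v : ℝ≥0} (hv : v ≠ 0) (P : ℝ≥0) :
    klDiv (additiveNoiseLaw φ p (gaussianReal 0 v)) (p.prod (gaussianReal 0 (P + v)))
        / ENNReal.ofReal (Real.log 2) =
      ENNReal.ofReal (awgnCapacity (P / v)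
        - (P - ∫ a, φ a ^ 2 ∂p) / (2 * (P + v) * Real.log 2)) := by
  have hPv : (P : ℝ) + v ≠ 0 := by positivity
  have hv' : (v : ℝ) ≠ 0 := by exact_mod_cast hv
  have h_snr : ((P + v : ℝ≥0) : ℝ) / v = 1 + P / v := by
    push_cast
    field_simp
    ring
  rw [klDiv_additiveNoiseLaw_gaussianReal hφm hφ hv (by positivity), h_snr,
    ← ENNReal.ofReal_div_of_pos (Real.log_pos one_lt_two), awgnCapacity_eq_log_div]
  push_cast
  congr 1
  field_simp
  ring

lemma mutualInfoBits_additiveNoiseLaw_le [StandardBorelSpace A] (hφ : Measurable φ) {v P : ℝ≥0}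
    (hv : v ≠ 0) (hP : ∫⁻ a, ENNReal.ofReal (φ a ^ 2) ∂p ≤ P) :
    mutualInfoBits (additiveNoiseLaw φ p (gaussianReal 0 v))
      ≤ ENNReal.ofReal (awgnCapacity (P / v)) := by
  have : Nonempty A := nonempty_of_isProbabilityMeasure p
  have := isProbabilityMeasure_additiveNoiseLaw hφ p (gaussianReal 0 v)
  refine (mutualInfoBits_le_klDiv_fst_prod _ (gaussianReal 0 (P + v))).trans ?_
  rw [fst_additiveNoiseLaw hφ, klDiv_additiveNoiseLaw_gaussianReal_div_log_two hφ
    (memLp_two_of_lintegral_sq_ne_top hφ (hP.trans_lt ENNReal.coe_lt_top).ne) hv]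
  have : 0 ≤ P - ∫ a, φ a ^ 2 ∂p := sub_nonneg.2 (integral_sq_le_of_lintegral_sq_le hφ hP)
  have : 0 < Real.log 2 := Real.log_pos one_lt_two
  exact ENNReal.ofReal_le_ofReal (sub_le_self _ (by positivity))

lemma mutualInfoBits_additiveNoiseLaw_gaussianReal {v : ℝ≥0} (hv : v ≠ 0) (P : ℝ≥0) :
    mutualInfoBits (additiveNoiseLaw id (gaussianReal 0 P) (gaussianReal 0 v))
      = ENNReal.ofReal (awgnCapacity (P / v)) := by
  have h := klDiv_additiveNoiseLaw_gaussianReal_div_log_two measurable_id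
    (memLp_id_gaussianReal (μ := 0) (v := P) 2) hv P
  change klDiv _ (Measure.prod (Measure.fst _) (Measure.snd _)) / _ = _
  rw [fst_additiveNoiseLaw measurable_id, snd_additiveNoiseLaw measurable_id, Measure.map_id,
    gaussianReal_conv_gaussianReal, zero_add, h]
  simp [integral_sq_gaussianReal]

end AdditiveNoise

/-! ### The relay channel -/

/-- Variance `α x² + σR2` of noise plus residual self-interference when the relay sends `x`. -/
noncomputable def relayNoiseVar (α σR2 : ℝ≥0) (x : ℝ) : ℝ≥0 :=
  NNReal.mk (x ^ 2) (sq_nonneg x) * α + σR2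

lemma coe_relayNoiseVar (α σR2 : ℝ≥0) (x : ℝ) :
    (relayNoiseVar α σR2 x : ℝ) = α * x ^ 2 + σR2 := by
  rw [relayNoiseVar, NNReal.coe_add, NNReal.coe_mul, mul_comm]
  rfl

lemma relayNoiseVar_ne_zero (α : ℝ≥0) {σR2 : ℝ≥0} (hσR : 0 < σR2) (x : ℝ) :
    relayNoiseVar α σR2 x ≠ 0 :=
  (hσR.trans_le le_add_self).ne'

lemma map_gain_mul_add_noise (α σR2 : ℝ≥0) (x : ℝ) :
    ((gaussianReal 0 α).prod (gaussianReal 0 σR2)).map (fun t => t.1 * x + t.2)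
      = gaussianReal 0 (relayNoiseVar α σR2 x) := by
  have h_conv := gaussianReal_conv_gaussianReal (m₁ := 0 * x) (m₂ := 0)
    (v₁ := NNReal.mk (x ^ 2) (sq_nonneg x) * α) (v₂ := σR2)
  rw [mul_comm 0 x, ← gaussianReal_map_mul_const, Measure.conv,
    ← Measure.map_id (μ := gaussianReal 0 σR2),
    Measure.map_prod_map _ _ (by fun_prop) (by fun_prop),
    Measure.map_map (by fun_prop) (by fun_prop), mul_zero, zero_add] at h_conv
  exact h_conv

lemma sourceRelayLaw_eq_additiveNoiseLaw (α σR2 : ℝ≥0) (x : ℝ) (p : Measure ℝ) [SFinite p] :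
    sourceRelayLaw α σR2 x p
      = additiveNoiseLaw id p (gaussianReal 0 (relayNoiseVar α σR2 x)) := by
  rw [additiveNoiseLaw, ← map_gain_mul_add_noise]
  nth_rw 2 [← Measure.map_id (μ := p)]
  rw [Measure.map_prod_map _ _ (by fun_prop) (by fun_prop),
    Measure.map_map (by fun_prop) (by fun_prop), sourceRelayLaw]
  simp only [Function.comp_def, Prod.map, id, add_assoc]

lemma sourceRelayInfoAt_le {α σR2 : ℝ≥0} (hσR : 0 < σR2) (x : ℝ) (p : Measure ℝ)
    [IsProbabilityMeasure p] {P : ℝ≥0} (hp : ∫⁻ s, ENNReal.ofReal (s ^ 2) ∂p ≤ P) :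
    sourceRelayInfoAt α σR2 x p ≤ ENNReal.ofReal (awgnCapacity (P / (α * x ^ 2 + σR2))) := by
  rw [sourceRelayInfoAt, sourceRelayLaw_eq_additiveNoiseLaw, ← coe_relayNoiseVar]
  exact mutualInfoBits_additiveNoiseLaw_le measurable_id (relayNoiseVar_ne_zero α hσR x) hp

lemma sourceRelayInfoAt_gaussianReal (α : ℝ≥0) {σR2 : ℝ≥0} (hσR : 0 < σR2) (x : ℝ) (P : ℝ≥0) :
    sourceRelayInfoAt α σR2 x (gaussianReal 0 P)
      = ENNReal.ofReal (awgnCapacity (P / (α * x ^ 2 + σR2))) := by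
  rw [sourceRelayInfoAt, sourceRelayLaw_eq_additiveNoiseLaw, ← coe_relayNoiseVar]
  exact mutualInfoBits_additiveNoiseLaw_gaussianReal (relayNoiseVar_ne_zero α hσR x) P

lemma sourcePower_zero (α : ℝ≥0) (xth : ℝ) : sourcePower α xth 0 = α * xth ^ 2 := by
  simp [sourcePower, max_eq_right (sq_nonneg xth)]

lemma sourcePower_nonneg (α : ℝ≥0) (xth x : ℝ) : 0 ≤ sourcePower α xth x :=
  mul_nonneg α.2 (le_max_left _ _)

lemma sourcePower_eq_sub_of_abs_lt (α : ℝ≥0) {xth x : ℝ} (hx : |x| < xth) :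
    sourcePower α xth x = α * xth ^ 2 - α * x ^ 2 := by
  have : x ^ 2 ≤ xth ^ 2 := sq_le_sq.2 (hx.le.trans (le_abs_self xth))
  rw [sourcePower, max_eq_right (by linarith), mul_sub]

lemma sourcePower_eq_zero_of_le_abs (α : ℝ≥0) {xth x : ℝ} (hxth : 0 ≤ xth) (hx : xth ≤ |x|) :
    sourcePower α xth x = 0 := by
  have : xth ^ 2 ≤ x ^ 2 := sq_le_sq.2 (by rwa [abs_of_nonneg hxth])
  rw [sourcePower, max_eq_left (by linarith), mul_zero]

lemma integrable_sourcePower (α : ℝ≥0) (xth : ℝ) (ν : Measure ℝ) [IsFiniteMeasure ν] :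
    Integrable (sourcePower α xth) ν := by
  have h_meas : Measurable (sourcePower α xth) := by
    unfold sourcePower
    fun_prop
  refine .of_bound h_meas.aestronglyMeasurable (α * xth ^ 2) (ae_of_all _ fun x => ?_)
  rw [Real.norm_of_nonneg (sourcePower_nonneg _ _ _), sourcePower]
  exact mul_le_mul_of_nonneg_left (max_le (sq_nonneg _) (by linarith [sq_nonneg x])) α.2

lemma isGreatest_sourceRelayInfoAt_zero (α : ℝ≥0) {σR2 : ℝ≥0} (hσR : 0 < σR2) (xth : ℝ) :
    IsGreatest
      {I : ℝ≥0∞ | ∃ p : Measure ℝ, IsProbabilityMeasure p ∧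
        ∫⁻ s, ENNReal.ofReal (s ^ 2) ∂p ≤ ENNReal.ofReal (sourcePower α xth 0) ∧
        I = sourceRelayInfoAt α σR2 0 p}
      (ENNReal.ofReal (awgnCapacity (α * xth ^ 2 / σR2))) := by
  have h_snr : α * xth ^ 2 / σR2 = (sourcePower α xth 0).toNNReal / (α * (0 : ℝ) ^ 2 + σR2) := by
    rw [Real.coe_toNNReal _ (sourcePower_nonneg α xth 0), sourcePower_zero]
    simp
  rw [h_snr]
  refine ⟨⟨gaussianReal 0 (sourcePower α xth 0).toNNReal, inferInstance,
    (lintegral_sq_gaussianReal _).le, (sourceRelayInfoAt_gaussianReal α hσR 0 _).symm⟩, ?_⟩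
  rintro _ ⟨p, _, h_power, rfl⟩
  exact sourceRelayInfoAt_le hσR 0 p h_power

lemma relayDestInfo_le (ν : Measure ℝ) [IsProbabilityMeasure ν] {σD2 P : ℝ≥0} (hσD : 0 < σD2)
    (hν : ∫⁻ x, ENNReal.ofReal (x ^ 2) ∂ν ≤ P) :
    relayDestInfo σD2 ν ≤ ENNReal.ofReal (awgnCapacity (P / σD2)) :=
  mutualInfoBits_additiveNoiseLaw_le measurable_id hσD.ne' hν

lemma relayCapacity_ne_top (α σR2 PS PR : ℝ≥0) {σD2 : ℝ≥0} (hσD : 0 < σD2) :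
    relayCapacity α σR2 σD2 PS PR ≠ ∞ :=
  ne_top_of_le_ne_top ENNReal.ofReal_ne_top <| iSup_le fun ν => iSup_le fun _ => iSup_le fun hν =>
    (min_le_right _ _).trans (relayDestInfo_le ν hσD hν)

/-! ### Water-filling -/

lemma awgnCapacity_mono {r s : ℝ} (hr : 0 ≤ r) (hrs : r ≤ s) : awgnCapacity r ≤ awgnCapacity s := by
  have : 0 < 1 + r := by positivity
  unfold awgnCapacity
  gcongr
  norm_num

lemma awgnCapacity_nonneg {r : ℝ} (hr : 0 ≤ r) : 0 ≤ awgnCapacity r := by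
  simpa [awgnCapacity] using awgnCapacity_mono le_rfl hr

lemma awgnCapacity_pos {r : ℝ} (hr : 0 < r) : 0 < awgnCapacity r :=
  mul_pos (by norm_num) (Real.logb_pos one_lt_two (by linarith))

lemma awgnCapacity_div_le_add_tangent {w l q : ℝ} (hw : 0 < w) (hl : 0 < l) (hq : 0 ≤ q) :
    awgnCapacity (q / w) ≤ awgnCapacity ((l - w) / w) + (w + q - l) / (2 * l * Real.log 2) := by
  have h_snr (u : ℝ) : 1 + u / w = (w + u) / w := by field_simp
  have h_tangent := Real.log_le_sub_one_of_pos (x := (w + q) / l) (by positivity)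
  have h_slope : (w + q - l) / (2 * l * Real.log 2)
      = 1 / 2 * ((w + q) / l - 1) / Real.log 2 := by field_simp
  have : 0 < Real.log 2 := Real.log_pos one_lt_two
  rw [Real.log_div (by positivity) hl.ne'] at h_tangent
  rw [awgnCapacity_eq_log_div, awgnCapacity_eq_log_div, h_snr, h_snr, add_sub_cancel, h_slope,
    Real.log_div (by positivity) hw.ne', Real.log_div hl.ne' hw.ne', ← add_div]
  gcongr
  linarith

/-- Slope, in bits per unit of power, of the capacity at the water level `α xth² + σR2`: the
Lagrange multiplier of the source's power constraint. -/
noncomputable def powerPrice (α σR2 : ℝ≥0) (xth : ℝ) : ℝ :=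
  1 / (2 * (α * xth ^ 2 + σR2) * Real.log 2)

lemma powerPrice_pos (α : ℝ≥0) {σR2 : ℝ≥0} (hσR : 0 < σR2) (xth : ℝ) :
    0 < powerPrice α σR2 xth := by
  have : 0 < Real.log 2 := Real.log_pos one_lt_two
  unfold powerPrice
  positivity

lemma awgnCapacity_div_add_sourcePower_le {α σR2 : ℝ≥0} (hσR : 0 < σR2) {xth : ℝ} (hxth : 0 ≤ xth)
    (x : ℝ) {q : ℝ} (hq : 0 ≤ q) :
    awgnCapacity (q / (α * x ^ 2 + σR2)) + powerPrice α σR2 xth * sourcePower α xth x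
      ≤ {x | |x| < xth}.indicator (fun _ => awgnCapacity (α * xth ^ 2 / σR2)) x
        + powerPrice α σR2 xth * q := by
  have : (0 : ℝ) < σR2 := hσR
  have hw : 0 < α * x ^ 2 + (σR2 : ℝ) := by positivity
  have hl : 0 < α * xth ^ 2 + (σR2 : ℝ) := by positivity
  simp only [powerPrice, one_div_mul_eq_div]
  rcases lt_or_ge |x| xth with hx | hx
  · have h_power := sourcePower_nonneg α xth x
    rw [sourcePower_eq_sub_of_abs_lt α hx] at h_power ⊢
    have h_tangent := awgnCapacity_div_le_add_tangent hw hl hq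
    have h_base : awgnCapacity ((α * xth ^ 2 + σR2 - (α * x ^ 2 + σR2)) / (α * x ^ 2 + σR2))
        ≤ awgnCapacity (α * xth ^ 2 / σR2) := by
      have : 0 ≤ α * x ^ 2 := by positivity
      refine awgnCapacity_mono (div_nonneg (by linarith) hw.le) ?_
      gcongr <;> linarith
    have h_split : α * x ^ 2 + σR2 + q - (α * xth ^ 2 + σR2)
        = q - (α * xth ^ 2 - α * x ^ 2) := by ring
    rw [Set.indicator_of_mem (by exact hx)]
    rw [h_split, sub_div q] at h_tangent
    linarith
  · have h_tangent := awgnCapacity_div_le_add_tangent hw hw hq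
    rw [sub_self, zero_div, add_sub_cancel_left] at h_tangent
    rw [Set.indicator_of_notMem (by exact hx.not_gt), sourcePower_eq_zero_of_le_abs α hxth hx,
      zero_div, zero_add, add_zero]
    have : xth ^ 2 ≤ x ^ 2 := sq_le_sq.2 (by rwa [abs_of_nonneg hxth])
    have : 0 < Real.log 2 := Real.log_pos one_lt_two
    calc awgnCapacity (q / (α * x ^ 2 + σR2))
        ≤ q / (2 * (α * x ^ 2 + σR2) * Real.log 2) := by simpa [awgnCapacity] using h_tangent
      _ ≤ q / (2 * (α * xth ^ 2 + σR2) * Real.log 2) := by gcongr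

lemma sourceRelayInfoAt_add_sourcePower_le {α σR2 : ℝ≥0} (hσR : 0 < σR2) {xth : ℝ} (hxth : 0 ≤ xth)
    (x : ℝ) (p : Measure ℝ) [IsProbabilityMeasure p] :
    sourceRelayInfoAt α σR2 x p + ENNReal.ofReal (powerPrice α σR2 xth * sourcePower α xth x)
      ≤ {x | |x| < xth}.indicator (fun _ => ENNReal.ofReal (awgnCapacity (α * xth ^ 2 / σR2))) x
        + ENNReal.ofReal (powerPrice α σR2 xth) * ∫⁻ s, ENNReal.ofReal (s ^ 2) ∂p := by
  have h_price := powerPrice_pos α hσR xth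
  rcases eq_or_ne (∫⁻ s, ENNReal.ofReal (s ^ 2) ∂p) ∞ with h_top | h_top
  · simp [h_top, ENNReal.mul_top, h_price]
  lift ∫⁻ s, ENNReal.ofReal (s ^ 2) ∂p to ℝ≥0 using h_top with q hq
  have h_indicator : {x | |x| < xth}.indicator
        (fun _ => ENNReal.ofReal (awgnCapacity (α * xth ^ 2 / σR2))) x
      = ENNReal.ofReal ({x | |x| < xth}.indicator
        (fun _ => awgnCapacity (α * xth ^ 2 / σR2)) x) := by
    by_cases hx : |x| < xth <;> simp [Set.indicator, hx]
  have h_indicator_nonneg : 0 ≤ {x | |x| < xth}.indicator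
      (fun _ => awgnCapacity (α * xth ^ 2 / σR2)) x :=
    Set.indicator_nonneg (fun _ _ => awgnCapacity_nonneg (by positivity)) x
  refine (add_le_add_left (sourceRelayInfoAt_le hσR x p hq.symm.le) _).trans ?_
  rw [h_indicator, ← ENNReal.ofReal_coe_nnreal, ← ENNReal.ofReal_mul h_price.le,
    ← ENNReal.ofReal_add h_indicator_nonneg (by positivity),
    ← ENNReal.ofReal_add (awgnCapacity_nonneg (by positivity))
      (mul_nonneg h_price.le (sourcePower_nonneg α xth x))]
  exact ENNReal.ofReal_le_ofReal (awgnCapacity_div_add_sourcePower_le hσR hxth x q.2)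

lemma lintegral_powerPrice_mul_sourcePower (α : ℝ≥0) {σR2 PS : ℝ≥0} (hσR : 0 < σR2) (ν : Measure ℝ)
    [IsFiniteMeasure ν] {xth : ℝ} (hpow : ∫ x, sourcePower α xth x ∂ν = PS) :
    ∫⁻ x, ENNReal.ofReal (powerPrice α σR2 xth * sourcePower α xth x) ∂ν
      = ENNReal.ofReal (powerPrice α σR2 xth) * PS := by
  have h_price := powerPrice_pos α hσR xth
  rw [← ofReal_integral_eq_lintegral_ofReal ((integrable_sourcePower α xth ν).const_mul _)
    (ae_of_all _ fun x => mul_nonneg h_price.le (sourcePower_nonneg α xth x)),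
    integral_const_mul, hpow, ENNReal.ofReal_mul h_price.le, ENNReal.ofReal_coe_nnreal]

/-- Weak duality: pricing the power at its marginal rate at the water level relaxes the power
constraint, and the relaxed problem decouples over the relay's symbols. -/
lemma sourceRelayRate_le {α σR2 PS : ℝ≥0} (hσR : 0 < σR2) (ν : Measure ℝ) [IsFiniteMeasure ν]
    {xth : ℝ} (hxth : 0 ≤ xth) (hpow : ∫ x, sourcePower α xth x ∂ν = PS) :
    sourceRelayRate α σR2 PS ν
      ≤ ENNReal.ofReal (awgnCapacity (α * xth ^ 2 / σR2) * transmitProb ν xth) := by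
  refine iSup_le fun κ => iSup_le fun _ => iSup_le fun hκ => ?_
  have h_below : MeasurableSet {x : ℝ | |x| < xth} := measurableSet_lt (by fun_prop) (by fun_prop)
  have h_power_meas : Measurable fun x =>
      ENNReal.ofReal (powerPrice α σR2 xth * sourcePower α xth x) := by
    unfold sourcePower
    fun_prop
  have h_relaxed := lintegral_mono (μ := ν)
    fun x => sourceRelayInfoAt_add_sourcePower_le (α := α) hσR hxth x (κ x)
  rw [lintegral_add_right _ h_power_meas, lintegral_powerPrice_mul_sourcePower α hσR ν hpow,
    lintegral_add_left (measurable_const.indicator h_below), lintegral_indicator_const h_below,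
    lintegral_const_mul _ (Measurable.lintegral_kernel (by fun_prop))] at h_relaxed
  rw [transmitProb, ENNReal.ofReal_mul (awgnCapacity_nonneg (by positivity)), ofReal_measureReal]
  refine (ENNReal.add_le_add_iff_right
    (ENNReal.mul_ne_top ENNReal.ofReal_ne_top ENNReal.coe_ne_top)).1 (h_relaxed.trans ?_)
  gcongr

lemma transmitProb_pos {α PS : ℝ≥0} (hPS : 0 < PS) (ν : Measure ℝ) [IsFiniteMeasure ν]
    {xth : ℝ} (hxth : 0 ≤ xth) (hpow : ∫ x, sourcePower α xth x ∂ν = PS) :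
    0 < transmitProb ν xth := by
  refine measureReal_nonneg.lt_of_ne fun h_zero => ?_
  have h_null : ν {x | |x| < xth} = 0 := (measureReal_eq_zero_iff).1 h_zero.symm
  have h_power_zero : ∫ x, sourcePower α xth x ∂ν = 0 := by
    refine integral_eq_zero_of_ae ?_
    filter_upwards [measure_eq_zero_iff_ae_notMem.1 h_null] with x hx
    exact sourcePower_eq_zero_of_le_abs α hxth (not_lt.1 hx)
  rw [h_power_zero] at hpow
  exact hPS.ne (NNReal.coe_injective (by simpa using hpow))

lemma toReal_relayCapacity_le {α σR2 σD2 PS PR : ℝ≥0} (hσR : 0 < σR2)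
    (ν : Measure ℝ) [IsFiniteMeasure ν] (hν : IsOptimalRelayInput α σR2 σD2 PS PR ν)
    {xth : ℝ} (hxth : 0 ≤ xth) (hpow : ∫ x, sourcePower α xth x ∂ν = PS) :
    (relayCapacity α σR2 σD2 PS PR).toReal
      ≤ awgnCapacity (α * xth ^ 2 / σR2) * transmitProb ν xth := by
  refine ENNReal.toReal_le_of_le_ofReal
    (mul_nonneg (awgnCapacity_nonneg (by positivity)) measureReal_nonneg) ?_
  rw [← hν.2]
  exact (min_le_left _ _).trans (sourceRelayRate_le hσR ν hxth hpow)

/-! ### Joint typicality -/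

section Pi

variable {Ω : Type*} [MeasurableSpace Ω] (μ : Measure Ω) [IsProbabilityMeasure μ]

lemma measurePreserving_infinitePi_comp {ι κ : Type*} [Fintype κ] {e : κ → ι}
    (he : Function.Injective e) :
    MeasurePreserving (fun (ω : ι → Ω) (j : κ) => ω (e j)) (Measure.infinitePi fun _ => μ)
      (Measure.pi fun _ => μ) := by
  refine ⟨by fun_prop, ?_⟩
  have h_indep : iIndepFun (fun (i : ι) (ω : ι → Ω) => ω i) (Measure.infinitePi fun _ => μ) :=
    iIndepFun_infinitePi (X := fun _ => id) fun _ => measurable_id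
  rw [(h_indep.precomp he).map_fun_eq_pi_map fun j => (measurable_pi_apply _).aemeasurable]
  simp_rw [Measure.infinitePi_map_eval]

lemma measurePreserving_pi_comp {ι κ : Type*} [Fintype ι] [Fintype κ] {e : κ → ι}
    (he : Function.Injective e) :
    MeasurePreserving (fun (ω : ι → Ω) (j : κ) => ω (e j)) (Measure.pi fun _ => μ)
      (Measure.pi fun _ => μ) := by
  simpa only [Measure.infinitePi_eq_pi] using measurePreserving_infinitePi_comp μ he

lemma tendstoInMeasure_average {F : Ω → ℝ} (hFm : Measurable F) (hF : Integrable F μ) :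
    TendstoInMeasure (Measure.infinitePi fun _ : ℕ => μ)
      (fun (n : ℕ) ω => 1 / (n : ℝ) * ∑ i : Fin n, F (ω i)) atTop (fun _ => ∫ z, F z ∂μ) := by
  let P : Measure (ℕ → Ω) := Measure.infinitePi fun _ => μ
  have h_eval (i : ℕ) : MeasurePreserving (fun ω : ℕ → Ω => ω i) P μ :=
    measurePreserving_eval_infinitePi (fun _ => μ) i
  have h_indep : iIndepFun (fun i ω => F (ω i)) P := iIndepFun_infinitePi fun _ => hFm
  have h_strong_law := strong_law_ae (μ := P) (fun i ω => F (ω i))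
    ((h_eval 0).integrable_comp_of_integrable hF) (fun i j hij => h_indep.indepFun hij)
    fun i => (IdentDistrib.mk (h_eval i).aemeasurable (h_eval 0).aemeasurable
      ((h_eval i).map_eq.trans (h_eval 0).map_eq.symm)).comp hFm
  have h_mean : ∫ ω, F (ω 0) ∂P = ∫ z, F z ∂μ := by
    rw [← (h_eval 0).map_eq, integral_map (h_eval 0).aemeasurable (by fun_prop)]
  rw [h_mean] at h_strong_law
  refine tendstoInMeasure_of_tendsto_ae
    (fun n => Measurable.aestronglyMeasurable (by fun_prop)) ?_
  simpa only [smul_eq_mul, ← one_div, Finset.sum_range] using h_strong_law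

lemma tendsto_measureReal_average_sub_integral_ge {F : Ω → ℝ} (hFm : Measurable F)
    (hF : Integrable F μ) {δ : ℝ} (hδ : 0 < δ) :
    Tendsto (fun n : ℕ => (Measure.pi fun _ : Fin n => μ).real
      {u | δ ≤ |1 / (n : ℝ) * ∑ i, F (u i) - ∫ z, F z ∂μ|}) atTop (𝓝 0) := by
  have h := tendstoInMeasure_iff_measureReal_norm.1 (tendstoInMeasure_average μ hFm hF) δ hδ
  refine h.congr fun n => ?_
  refine (measurePreserving_infinitePi_comp μ Fin.val_injective).measureReal_preimage
    (s := {u : Fin n → Ω | δ ≤ |1 / (n : ℝ) * ∑ i, F (u i) - ∫ z, F z ∂μ|}) ?_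
  exact (measurableSet_le measurable_const (by fun_prop)).nullMeasurableSet

end Pi

lemma integral_neg_logb_withRealDensity {E : Type*} [MeasureSpace E] {g : E → ℝ}
    (hg : Measurable g) (hg0 : ∀ z, 0 ≤ g z) :
    ∫ z, -Real.logb 2 (g z) ∂withRealDensity volume g = diffEntropyBits g := by
  rw [integral_withDensity_eq_integral_toReal_smul (by fun_prop)
    (ae_of_all _ fun z => ENNReal.ofReal_lt_top), diffEntropyBits, ← integral_neg]
  simp only [smul_eq_mul, mul_neg, ENNReal.toReal_ofReal (hg0 _)]

lemma typicalDecoder_eq_some {f : ℝ → ℝ → ℝ} {δ : ℝ} {M : Type*} {n : ℕ} {c : M → Fin n → ℝ}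
    {y : Fin n → ℝ} {w : M} (hw : JointlyTypical f δ (c w) y)
    (h : ∀ w', w' ≠ w → ¬ JointlyTypical f δ (c w') y) : typicalDecoder f δ c y = some w := by
  have h_unique (w' : M) (hw' : JointlyTypical f δ (c w') y) : w' = w :=
    by_contra fun hne => h w' hne hw'
  have h_exists : ∃! w, JointlyTypical f δ (c w) y := ⟨w, hw, h_unique⟩
  rw [typicalDecoder, dif_pos h_exists, h_unique _ h_exists.choose_spec.1]

lemma neg_inv_mul_logb_prod {n : ℕ} {a : Fin n → ℝ} (ha : ∀ i, a i ≠ 0) :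
    -(1 / (n : ℝ)) * Real.logb 2 (∏ i, a i) = 1 / (n : ℝ) * ∑ i, -Real.logb 2 (a i) := by
  rw [Real.logb_prod _ _ fun i _ => ha i, Finset.sum_neg_distrib]
  ring

lemma integral_pos_of_forall_pos {g : ℝ → ℝ} (hg : Integrable g) (hg0 : ∀ x, 0 < g x) :
    0 < ∫ x, g x := by
  rw [integral_pos_iff_support_of_nonneg (fun x => (hg0 x).le) hg,
    Function.support_eq_univ fun x => (hg0 x).ne']
  exact Measure.measure_univ_pos.2 (NeZero.ne _)

/-- The law on `ℝ × ℝ` with joint density `f` with respect to Lebesgue measure. -/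
noncomputable def jointLaw (f : ℝ → ℝ → ℝ) : Measure (ℝ × ℝ) :=
  withRealDensity volume fun z => f z.1 z.2

/-- `I(X; Y) = h(X) + h(Y) - h(X, Y)`, in bits, for a pair with joint density `f`. -/
noncomputable def densityMutualInfo (f : ℝ → ℝ → ℝ) : ℝ :=
  diffEntropyBits (margFst f) + diffEntropyBits (margSnd f)
    - diffEntropyBits fun z : ℝ × ℝ => f z.1 z.2

/-- `f` is an everywhere positive probability density on `ℝ × ℝ`. Integrability of every section,
and not just of almost every one, makes the marginal densities positive everywhere, so that the
logarithms in `JointlyTypical` never take their junk value at `0`. -/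
structure IsPositiveJointDensity (f : ℝ → ℝ → ℝ) : Prop where
  measurable : Measurable fun z : ℝ × ℝ => f z.1 z.2
  pos : ∀ x y, 0 < f x y
  integrable_left : ∀ x, Integrable (f x)
  integrable_right : ∀ y, Integrable fun x => f x y
  isProbabilityMeasure : IsProbabilityMeasure (jointLaw f)

/-- The logarithms of the three densities in `JointlyTypical` are integrable, so that `h(X)`, `h(Y)`
and `h(X, Y)` are genuine expectations and the law of large numbers applies to them. -/
structure HasFiniteEntropies (f : ℝ → ℝ → ℝ) : Prop where
  integrable_fst : Integrable (fun z => Real.logb 2 (margFst f z.1)) (jointLaw f)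
  integrable_snd : Integrable (fun z => Real.logb 2 (margSnd f z.2)) (jointLaw f)
  integrable_joint : Integrable (fun z => Real.logb 2 (f z.1 z.2)) (jointLaw f)

namespace IsPositiveJointDensity

variable {f : ℝ → ℝ → ℝ} (hf : IsPositiveJointDensity f)
include hf

lemma margFst_pos (x : ℝ) : 0 < margFst f x :=
  integral_pos_of_forall_pos (hf.integrable_left x) (hf.pos x)

lemma margSnd_pos (y : ℝ) : 0 < margSnd f y :=
  integral_pos_of_forall_pos (hf.integrable_right y) fun x => hf.pos x y

lemma measurable_margFst : Measurable (margFst f) :=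
  hf.measurable.stronglyMeasurable.integral_prod_right'.measurable

lemma measurable_margSnd : Measurable (margSnd f) :=
  hf.measurable.stronglyMeasurable.integral_prod_left'.measurable

lemma fst_jointLaw : (jointLaw f).fst = withRealDensity volume (margFst f) := by
  have h_measurable := hf.measurable
  have h_margFst := hf.measurable_margFst
  refine Measure.ext_of_lintegral _ fun g hg => ?_
  rw [Measure.fst, lintegral_map hg measurable_fst, jointLaw,
    lintegral_withDensity_eq_lintegral_mul _ (by fun_prop) (by fun_prop), Measure.volume_eq_prod,
    lintegral_prod _ (by fun_prop), lintegral_withDensity_eq_lintegral_mul _ (by fun_prop) hg]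
  refine lintegral_congr fun x => ?_
  simp only [Pi.mul_apply]
  rw [lintegral_mul_const _ (by fun_prop), margFst,
    ofReal_integral_eq_lintegral_ofReal (hf.integrable_left x)
      (ae_of_all _ fun y => (hf.pos x y).le)]

lemma snd_jointLaw : (jointLaw f).snd = withRealDensity volume (margSnd f) := by
  have h_measurable := hf.measurable
  have h_margSnd := hf.measurable_margSnd
  refine Measure.ext_of_lintegral _ fun g hg => ?_
  rw [Measure.snd, lintegral_map hg measurable_snd, jointLaw,
    lintegral_withDensity_eq_lintegral_mul _ (by fun_prop) (by fun_prop), Measure.volume_eq_prod,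
    lintegral_prod_symm _ (by fun_prop), lintegral_withDensity_eq_lintegral_mul _ (by fun_prop) hg]
  refine lintegral_congr fun y => ?_
  simp only [Pi.mul_apply]
  rw [lintegral_mul_const _ (by fun_prop), margSnd,
    ofReal_integral_eq_lintegral_ofReal (hf.integrable_right y)
      (ae_of_all _ fun x => (hf.pos x y).le)]

lemma isProbabilityMeasure_margFst : IsProbabilityMeasure (withRealDensity volume (margFst f)) := by
  have := hf.isProbabilityMeasure
  rw [← hf.fst_jointLaw]
  infer_instance

lemma jointlyTypical_iff {δ : ℝ} {n : ℕ} {x y : Fin n → ℝ} :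
    JointlyTypical f δ x y ↔
      |1 / (n : ℝ) * ∑ i, -Real.logb 2 (margFst f (x i)) - diffEntropyBits (margFst f)| < δ ∧
      |1 / (n : ℝ) * ∑ i, -Real.logb 2 (margSnd f (y i)) - diffEntropyBits (margSnd f)| < δ ∧
      |1 / (n : ℝ) * ∑ i, -Real.logb 2 (f (x i) (y i))
        - diffEntropyBits (fun z : ℝ × ℝ => f z.1 z.2)| < δ := by
  rw [JointlyTypical, neg_inv_mul_logb_prod fun i => (hf.margFst_pos (x i)).ne',
    neg_inv_mul_logb_prod fun i => (hf.margSnd_pos (y i)).ne',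
    neg_inv_mul_logb_prod fun i => (hf.pos (x i) (y i)).ne']

lemma measurableSet_jointlyTypical (δ : ℝ) (n : ℕ) :
    MeasurableSet {z : (Fin n → ℝ) × (Fin n → ℝ) | JointlyTypical f δ z.1 z.2} := by
  have h_fst := hf.measurable_margFst
  have h_snd := hf.measurable_margSnd
  have h_joint : Measurable fun z : (Fin n → ℝ) × (Fin n → ℝ) => ∏ i, f (z.1 i) (z.2 i) :=
    Finset.measurable_fun_prod _ fun i _ => hf.measurable.comp
      (f := fun z : (Fin n → ℝ) × (Fin n → ℝ) => (z.1 i, z.2 i)) (by fun_prop)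
  simp only [JointlyTypical, Real.logb, Set.ofPred_and]
  refine .inter ?_ (.inter ?_ ?_)
  · exact measurableSet_lt (by fun_prop) measurable_const
  · exact measurableSet_lt (by fun_prop) measurable_const
  · exact measurableSet_lt (((h_joint.log.div_const _).const_mul _).sub_const _).norm
      measurable_const

lemma integral_neg_logb_margFst :
    ∫ z, -Real.logb 2 (margFst f z.1) ∂jointLaw f = diffEntropyBits (margFst f) := by
  have h_measurable : Measurable fun x => -Real.logb 2 (margFst f x) :=
    (hf.measurable_margFst.log.div_const _).neg
  rw [← integral_neg_logb_withRealDensity hf.measurable_margFst fun x => (hf.margFst_pos x).le,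
    ← hf.fst_jointLaw, Measure.fst, integral_map (by fun_prop)
      h_measurable.aestronglyMeasurable]

lemma integral_neg_logb_margSnd :
    ∫ z, -Real.logb 2 (margSnd f z.2) ∂jointLaw f = diffEntropyBits (margSnd f) := by
  have h_measurable : Measurable fun y => -Real.logb 2 (margSnd f y) :=
    (hf.measurable_margSnd.log.div_const _).neg
  rw [← integral_neg_logb_withRealDensity hf.measurable_margSnd fun y => (hf.margSnd_pos y).le,
    ← hf.snd_jointLaw, Measure.snd, integral_map (by fun_prop)
      h_measurable.aestronglyMeasurable]

lemma tendsto_measureReal_not_jointlyTypical (he : HasFiniteEntropies f) {δ : ℝ} (hδ : 0 < δ) :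
    Tendsto (fun n : ℕ => (Measure.pi fun _ : Fin n => jointLaw f).real
      {u | ¬ JointlyTypical f δ (fun i => (u i).1) fun i => (u i).2}) atTop (𝓝 0) := by
  have := hf.isProbabilityMeasure
  have h_average {F : ℝ × ℝ → ℝ} (hFm : Measurable F)
      (hF : Integrable (fun z => Real.logb 2 (F z)) (jointLaw f)) :=
    tendsto_measureReal_average_sub_integral_ge (jointLaw f) (hFm.log.div_const _).neg hF.neg hδ
  have h_lim := ((h_average (hf.measurable_margFst.comp measurable_fst) he.integrable_fst).add
    (h_average (hf.measurable_margSnd.comp measurable_snd) he.integrable_snd)).add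
    (h_average hf.measurable he.integrable_joint)
  simp only [add_zero] at h_lim
  refine squeeze_zero (fun n => measureReal_nonneg) (fun n => ?_) h_lim
  refine (measureReal_mono fun u hu => ?_).trans ((measureReal_union_le _ _).trans
    (add_le_add_left (measureReal_union_le _ _) _))
  by_contra h_all
  simp only [Set.mem_union, Set.mem_ofPred_eq, not_or, not_le, and_assoc] at h_all
  refine hu (hf.jointlyTypical_iff.2 ?_)
  rw [← hf.integral_neg_logb_margFst, ← hf.integral_neg_logb_margSnd,
    ← integral_neg_logb_withRealDensity hf.measurable fun z => (hf.pos z.1 z.2).le]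
  exact h_all

lemma two_rpow_le_prod_of_jointlyTypical {δ : ℝ} {n : ℕ} {x y : Fin n → ℝ}
    (h : JointlyTypical f δ x y) :
    (2 : ℝ) ^ (n * (densityMutualInfo f - 3 * δ)) ≤
      ∏ i, f (x i) (y i) / (margFst f (x i) * margSnd f (y i)) := by
  have h_ratio_pos (i : Fin n) : 0 < f (x i) (y i) / (margFst f (x i) * margSnd f (y i)) :=
    div_pos (hf.pos _ _) (mul_pos (hf.margFst_pos _) (hf.margSnd_pos _))
  rw [← Real.le_logb_iff_rpow_le one_lt_two (Finset.prod_pos fun i _ => h_ratio_pos i)]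
  obtain rfl | hn := n.eq_zero_or_pos
  · simp
  have h_logb : Real.logb 2 (∏ i, f (x i) (y i) / (margFst f (x i) * margSnd f (y i))) =
      ∑ i, -Real.logb 2 (margFst f (x i)) + ∑ i, -Real.logb 2 (margSnd f (y i))
        - ∑ i, -Real.logb 2 (f (x i) (y i)) := by
    rw [Real.logb_prod _ _ fun i _ => (h_ratio_pos i).ne', ← Finset.sum_add_distrib,
      ← Finset.sum_sub_distrib]
    refine Finset.sum_congr rfl fun i _ => ?_
    rw [Real.logb_div (hf.pos _ _).ne' (mul_pos (hf.margFst_pos _) (hf.margSnd_pos _)).ne',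
      Real.logb_mul (hf.margFst_pos _).ne' (hf.margSnd_pos _).ne']
    ring
  obtain ⟨h_fst, h_snd, h_joint⟩ := hf.jointlyTypical_iff.1 h
  rw [← le_div_iff₀' (by exact_mod_cast hn), ← one_div_mul_eq_div, h_logb, densityMutualInfo]
  linarith [(abs_lt.1 h_fst).1, (abs_lt.1 h_snd).1, (abs_lt.1 h_joint).2]

lemma integrable_and_integral_likelihoodRatio (y : ℝ) :
    Integrable (fun x => f x y / (margFst f x * margSnd f y))
        (withRealDensity volume (margFst f)) ∧
      ∫ x, f x y / (margFst f x * margSnd f y) ∂withRealDensity volume (margFst f) = 1 := by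
  have h_margFst := hf.measurable_margFst
  have h_density (x : ℝ) : (ENNReal.ofReal (margFst f x)).toReal •
      (f x y / (margFst f x * margSnd f y)) = f x y / margSnd f y := by
    have := (hf.margFst_pos x).ne'
    rw [ENNReal.toReal_ofReal (hf.margFst_pos x).le, smul_eq_mul]
    field_simp
  rw [integrable_withDensity_iff_integrable_smul' (by fun_prop)
    (ae_of_all _ fun x => ENNReal.ofReal_lt_top), integral_withDensity_eq_integral_toReal_smul
    (by fun_prop) (ae_of_all _ fun x => ENNReal.ofReal_lt_top)]
  simp_rw [h_density, integral_div]
  exact ⟨(hf.integrable_right y).div_const _, div_self (hf.margSnd_pos y).ne'⟩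

/-- The likelihood ratio of `x` has mean `1` and is exponentially large on typical pairs. -/
lemma measureReal_jointlyTypical_le (δ : ℝ) {n : ℕ} (y : Fin n → ℝ) :
    (Measure.pi fun _ : Fin n => withRealDensity volume (margFst f)).real
        {x | JointlyTypical f δ x y}
      ≤ 2 ^ (-(n * (densityMutualInfo f - 3 * δ))) := by
  have := hf.isProbabilityMeasure_margFst
  have h_markov := mul_meas_ge_le_integral_of_nonneg
    (μ := Measure.pi fun _ : Fin n => withRealDensity volume (margFst f))
    (f := fun x => ∏ i, f (x i) (y i) / (margFst f (x i) * margSnd f (y i)))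
    (ae_of_all _ fun x => Finset.prod_nonneg fun i _ =>
      (div_pos (hf.pos _ _) (mul_pos (hf.margFst_pos _) (hf.margSnd_pos _))).le)
    (Integrable.fintype_prod fun i => (hf.integrable_and_integral_likelihoodRatio (y i)).1)
    (2 ^ (n * (densityMutualInfo f - 3 * δ)))
  rw [integral_fintype_prod_eq_prod fun i x => f x (y i) / (margFst f x * margSnd f (y i))]
    at h_markov
  simp only [(hf.integrable_and_integral_likelihoodRatio _).2, Finset.prod_const_one] at h_markov
  refine (measureReal_mono fun x hx => hf.two_rpow_le_prod_of_jointlyTypical hx).trans ?_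
  rwa [Real.rpow_neg two_pos.le, ← one_div, le_div_iff₀' (by positivity)]

section RandomCoding

variable {Ω : Type*} [MeasurableSpace Ω] {P : Measure Ω} {n : ℕ} {Y : Ω → Fin n → ℝ}

lemma measureReal_jointlyTypical_le_of_indepFun [IsProbabilityMeasure P] (δ : ℝ) {X : Ω → Fin n → ℝ}
    (hX : MeasurePreserving X P (Measure.pi fun _ => withRealDensity volume (margFst f)))
    (hY : Measurable Y) (h_indep : IndepFun X Y P) :
    P.real {ω | JointlyTypical f δ (X ω) (Y ω)} ≤
      2 ^ (-(n * (densityMutualInfo f - 3 * δ))) := by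
  have := hf.isProbabilityMeasure_margFst
  have h_law := h_indep.map_prod_eq_prod_map_map hX.aemeasurable hY.aemeasurable
  have h_set := hf.measurableSet_jointlyTypical δ n
  refine ENNReal.toReal_le_of_le_ofReal (by positivity) ?_
  calc P {ω | JointlyTypical f δ (X ω) (Y ω)}
      = (P.map fun ω => (X ω, Y ω)) {p | JointlyTypical f δ p.1 p.2} :=
        (Measure.map_apply (hX.measurable.prodMk hY) h_set).symm
    _ = ∫⁻ y, (Measure.pi fun _ => withRealDensity volume (margFst f))
          {x | JointlyTypical f δ x y} ∂P.map Y := by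
        rw [h_law, hX.map_eq, Measure.prod_apply_symm h_set]
        rfl
    _ ≤ ∫⁻ _, ENNReal.ofReal (2 ^ (-(n * (densityMutualInfo f - 3 * δ)))) ∂P.map Y := by
        refine lintegral_mono fun y => ?_
        rw [← ofReal_measureReal]
        exact ENNReal.ofReal_le_ofReal (hf.measureReal_jointlyTypical_le δ y)
    _ = ENNReal.ofReal (2 ^ (-(n * (densityMutualInfo f - 3 * δ)))) := by
        have := Measure.isProbabilityMeasure_map (μ := P) hY.aemeasurable
        rw [lintegral_const, measure_univ, mul_one]

lemma measureReal_typicalDecoder_ne_le [IsProbabilityMeasure P] (δ : ℝ) {M : Type*} [Fintype M]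
    {X : M → Ω → Fin n → ℝ} {w : M}
    (h_sent : MeasurePreserving (fun ω i => (X w ω i, Y ω i)) P (Measure.pi fun _ => jointLaw f))
    (h_codeword : ∀ w', MeasurePreserving (X w') P
      (Measure.pi fun _ => withRealDensity volume (margFst f)))
    (hY : Measurable Y) (h_indep : ∀ w', w' ≠ w → IndepFun (X w') Y P) :
    P.real {ω | typicalDecoder f δ (fun w' => X w' ω) (Y ω) ≠ some w} ≤
      (Measure.pi fun _ : Fin n => jointLaw f).real
          {u | ¬ JointlyTypical f δ (fun i => (u i).1) fun i => (u i).2}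
        + Fintype.card M * 2 ^ (-(n * (densityMutualInfo f - 3 * δ))) := by
  classical
  have h_union : {ω | typicalDecoder f δ (fun w' => X w' ω) (Y ω) ≠ some w} ⊆
      {ω | ¬ JointlyTypical f δ (X w ω) (Y ω)} ∪
        ⋃ w' ∈ Finset.univ.erase w, {ω | JointlyTypical f δ (X w' ω) (Y ω)} := by
    intro ω h_error
    by_contra h_good
    simp only [Set.mem_union, Set.mem_ofPred_eq, Set.mem_iUnion, not_or, not_not, not_exists,
      Finset.mem_erase, Finset.mem_univ, and_true] at h_good
    exact h_error (typicalDecoder_eq_some h_good.1 h_good.2)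
  have h_missed : P.real {ω | ¬ JointlyTypical f δ (X w ω) (Y ω)} =
      (Measure.pi fun _ : Fin n => jointLaw f).real
        {u | ¬ JointlyTypical f δ (fun i => (u i).1) fun i => (u i).2} := by
    have h_set := ((hf.measurableSet_jointlyTypical δ n).preimage
      (f := fun u : Fin n → ℝ × ℝ => (fun i => (u i).1, fun i => (u i).2)) (by fun_prop)).compl
    exact h_sent.measureReal_preimage h_set.nullMeasurableSet
  have h_confused : P.real (⋃ w' ∈ Finset.univ.erase w, {ω | JointlyTypical f δ (X w' ω) (Y ω)})
      ≤ Fintype.card M * 2 ^ (-(n * (densityMutualInfo f - 3 * δ))) := by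
    refine (measureReal_biUnion_finset_le _ _).trans ((Finset.sum_le_card_nsmul _ _ _
      fun w' hw' => hf.measureReal_jointlyTypical_le_of_indepFun δ (h_codeword w') hY
        (h_indep w' (Finset.ne_of_mem_erase hw'))).trans ?_)
    rw [nsmul_eq_mul]
    gcongr
    exact Finset.card_le_univ _
  exact (measureReal_mono h_union).trans ((measureReal_union_le _ _).trans
    (add_le_add h_missed.le h_confused))

end RandomCoding

end IsPositiveJointDensity

/-! ### The Gaussian joint density -/

lemma logb_gaussianPDFReal (m : ℝ) {v : ℝ≥0} (hv : v ≠ 0) (x : ℝ) :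
    Real.logb 2 (gaussianPDFReal m v x)
      = -(1 / 2 * Real.logb 2 (2 * Real.pi * v)) - (x - m) ^ 2 / (2 * v * Real.log 2) := by
  rw [Real.logb, log_gaussianPDFReal m hv, Real.logb, sub_div, neg_div, mul_div_assoc, div_div]

lemma integrable_logb_gaussianPDFReal {Ω : Type*} [MeasurableSpace Ω] {P : Measure Ω}
    [IsFiniteMeasure P] {X : Ω → ℝ} (hX : MemLp X 2 P) {v : ℝ≥0} (hv : v ≠ 0) :
    Integrable (fun ω => Real.logb 2 (gaussianPDFReal 0 v (X ω))) P := by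
  simp_rw [logb_gaussianPDFReal 0 hv, sub_zero]
  exact (integrable_const _ : Integrable (fun _ => _) P).sub (hX.integrable_sq.div_const _)

lemma integral_neg_logb_gaussianReal {v : ℝ≥0} (hv : v ≠ 0) :
    ∫ x, -Real.logb 2 (gaussianPDFReal 0 v x) ∂gaussianReal 0 v
      = diffEntropyBits (gaussianPDFReal 0 v) := by
  rw [gaussianReal_of_var_ne_zero _ hv]
  exact integral_neg_logb_withRealDensity (measurable_gaussianPDFReal 0 v)
    (gaussianPDFReal_nonneg 0 v)

lemma diffEntropyBits_gaussianPDFReal {v : ℝ≥0} (hv : v ≠ 0) :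
    diffEntropyBits (gaussianPDFReal 0 v)
      = 1 / 2 * Real.logb 2 (2 * Real.pi * v) + 1 / (2 * Real.log 2) := by
  have hv' : (v : ℝ) ≠ 0 := by exact_mod_cast hv
  have h_sq : Integrable (fun x : ℝ => x ^ 2) (gaussianReal 0 v) :=
    (memLp_id_gaussianReal (μ := 0) (v := v) 2).integrable_sq
  rw [← integral_neg_logb_gaussianReal hv, integral_neg]
  simp_rw [logb_gaussianPDFReal 0 hv, sub_zero]
  rw [integral_sub (integrable_const _) (h_sq.div_const _), integral_const, integral_div,
    integral_sq_gaussianReal, probReal_univ, one_smul, neg_sub, sub_neg_eq_add, add_comm]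
  field_simp

section AwgnDensity

/-- Joint density of the input `X ∼ N(0, 1)` and the output `Y = s X + Z` of the Gaussian channel
with amplification `s` and independent noise `Z ∼ N(0, v)`. -/
noncomputable def awgnDensity (s : ℝ) (v : ℝ≥0) (x y : ℝ) : ℝ :=
  gaussianPDFReal 0 1 x * gaussianPDFReal (s * x) v y

/-- Variance of the output `s X + Z` of the Gaussian channel, as an `ℝ≥0` since this is how
`gaussianReal` takes its variance. -/
noncomputable def awgnOutputVariance (s : ℝ) (v : ℝ≥0) : ℝ≥0 := NNReal.mk (s ^ 2) (sq_nonneg s) + v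

variable (s : ℝ) {v : ℝ≥0}

lemma coe_awgnOutputVariance (v : ℝ≥0) : (awgnOutputVariance s v : ℝ) = s ^ 2 + v := rfl

lemma awgnOutputVariance_ne_zero (hv : v ≠ 0) : awgnOutputVariance s v ≠ 0 :=
  ((pos_iff_ne_zero.2 hv).trans_le le_add_self).ne'

lemma awgnDensity_eq_mul_backward (hv : v ≠ 0) (x y : ℝ) :
    awgnDensity s v x y = gaussianPDFReal 0 (awgnOutputVariance s v) y
      * gaussianPDFReal (s * y / awgnOutputVariance s v) (v / awgnOutputVariance s v) x := by
  have : (0 : ℝ) < v := by positivity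
  have : (0 : ℝ) < s ^ 2 + v := by positivity
  simp only [awgnDensity, gaussianPDFReal, NNReal.coe_div, coe_awgnOutputVariance, NNReal.coe_one]
  rw [mul_mul_mul_comm, mul_mul_mul_comm (√(2 * Real.pi * (s ^ 2 + v)))⁻¹, ← Real.exp_add,
    ← Real.exp_add, ← mul_inv, ← mul_inv, ← Real.sqrt_mul (by positivity),
    ← Real.sqrt_mul (by positivity)]
  refine congrArg₂ (· * ·) (congrArg (fun t => (√t)⁻¹) ?_) (congrArg Real.exp ?_)
  · field_simp
  · field_simp
    ring

lemma margFst_awgnDensity (hv : v ≠ 0) : margFst (awgnDensity s v) = gaussianPDFReal 0 1 := by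
  ext x
  simp only [margFst, awgnDensity]
  rw [integral_const_mul, integral_gaussianPDFReal_eq_one _ hv, mul_one]

lemma withRealDensity_margFst_awgnDensity (hv : v ≠ 0) :
    withRealDensity volume (margFst (awgnDensity s v)) = gaussianReal 0 1 := by
  rw [margFst_awgnDensity s hv, gaussianReal_of_var_ne_zero _ one_ne_zero]
  rfl

lemma margSnd_awgnDensity (hv : v ≠ 0) :
    margSnd (awgnDensity s v) = gaussianPDFReal 0 (awgnOutputVariance s v) := by
  ext y
  simp only [margSnd, awgnDensity_eq_mul_backward s hv]
  rw [integral_const_mul, integral_gaussianPDFReal_eq_one _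
    (div_ne_zero hv (awgnOutputVariance_ne_zero s hv)), mul_one]

lemma measurable_awgnDensity (v : ℝ≥0) : Measurable fun z : ℝ × ℝ => awgnDensity s v z.1 z.2 :=
  ((measurable_gaussianPDFReal 0 1).comp measurable_fst).mul
    (measurable_gaussianPDFReal_comp (by fun_prop) v)

lemma jointLaw_awgnDensity (hv : v ≠ 0) :
    jointLaw (awgnDensity s v) =
      additiveNoiseLaw (s * ·) (gaussianReal 0 1) (gaussianReal 0 v) := by
  have := measurable_gaussianPDFReal_comp (measurable_const_mul s) v
  rw [additiveNoiseLaw_gaussianReal (by fun_prop) _ hv,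
    gaussianReal_of_var_ne_zero _ one_ne_zero, prod_withDensity_left (measurable_gaussianPDF 0 1),
    withRealDensity, ← withDensity_mul _ (by fun_prop) (by fun_prop)]
  refine congrArg (Measure.withDensity _) (funext fun z => ?_)
  exact ENNReal.ofReal_mul (gaussianPDFReal_nonneg 0 1 z.1)

lemma isPositiveJointDensity_awgnDensity (hv : v ≠ 0) :
    IsPositiveJointDensity (awgnDensity s v) where
  measurable := measurable_awgnDensity s v
  pos x y := mul_pos (gaussianPDFReal_pos _ _ _ one_ne_zero) (gaussianPDFReal_pos _ _ _ hv)
  integrable_left x := (integrable_gaussianPDFReal _ _).const_mul _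
  integrable_right y := by
    simp_rw [awgnDensity_eq_mul_backward s hv]
    exact (integrable_gaussianPDFReal _ _).const_mul _
  isProbabilityMeasure := by
    rw [jointLaw_awgnDensity s hv]
    exact isProbabilityMeasure_additiveNoiseLaw (by fun_prop) _ _

lemma logb_awgnDensity (hv : v ≠ 0) (x y : ℝ) :
    Real.logb 2 (awgnDensity s v x y)
      = Real.logb 2 (gaussianPDFReal 0 1 x) + Real.logb 2 (gaussianPDFReal 0 v (y - s * x)) := by
  rw [gaussianPDFReal_sub, zero_add, awgnDensity,
    Real.logb_mul (gaussianPDFReal_pos _ _ _ one_ne_zero).ne' (gaussianPDFReal_pos _ _ _ hv).ne']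

lemma hasFiniteEntropies_awgnDensity (hv : v ≠ 0) : HasFiniteEntropies (awgnDensity s v) := by
  have := (isPositiveJointDensity_awgnDensity s hv).isProbabilityMeasure
  have h_input : MemLp Prod.fst 2 (jointLaw (awgnDensity s v)) := by
    rw [jointLaw_awgnDensity s hv, additiveNoiseLaw,
      memLp_map_measure_iff (by fun_prop) (by fun_prop)]
    exact (memLp_id_gaussianReal 2).comp_fst _
  have h_output : MemLp Prod.snd 2 (jointLaw (awgnDensity s v)) := by
    rw [jointLaw_awgnDensity s hv, additiveNoiseLaw,
      memLp_map_measure_iff (by fun_prop) (by fun_prop)]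
    exact memLp_output_gaussianReal ((memLp_id_gaussianReal 2).const_mul s) v
  refine ⟨?_, ?_, ?_⟩
  · rw [margFst_awgnDensity s hv]
    exact integrable_logb_gaussianPDFReal h_input one_ne_zero
  · rw [margSnd_awgnDensity s hv]
    exact integrable_logb_gaussianPDFReal h_output (awgnOutputVariance_ne_zero s hv)
  · simp_rw [logb_awgnDensity s hv]
    exact (integrable_logb_gaussianPDFReal h_input one_ne_zero).add
      (integrable_logb_gaussianPDFReal (h_output.sub (h_input.const_mul s)) hv)

lemma diffEntropyBits_awgnDensity (hv : v ≠ 0) :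
    diffEntropyBits (fun z : ℝ × ℝ => awgnDensity s v z.1 z.2)
      = diffEntropyBits (gaussianPDFReal 0 1) + diffEntropyBits (gaussianPDFReal 0 v) := by
  have hf := isPositiveJointDensity_awgnDensity s hv
  have h_logb : Measurable fun z : ℝ × ℝ => -Real.logb 2 (awgnDensity s v z.1 z.2) :=
    (hf.measurable.log.div_const _).neg
  have h_finite {u : ℝ≥0} (hu : u ≠ 0) :
      Integrable (fun x => -Real.logb 2 (gaussianPDFReal 0 u x)) (gaussianReal 0 u) :=
    (integrable_logb_gaussianPDFReal (memLp_id_gaussianReal 2) hu).neg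
  calc diffEntropyBits (fun z : ℝ × ℝ => awgnDensity s v z.1 z.2)
      = ∫ z, -Real.logb 2 (awgnDensity s v z.1 z.2) ∂jointLaw (awgnDensity s v) :=
        (integral_neg_logb_withRealDensity hf.measurable fun z => (hf.pos z.1 z.2).le).symm
    _ = ∫ t, (-Real.logb 2 (gaussianPDFReal 0 1 t.1) + -Real.logb 2 (gaussianPDFReal 0 v t.2))
          ∂(gaussianReal 0 1).prod (gaussianReal 0 v) := by
        rw [jointLaw_awgnDensity s hv, additiveNoiseLaw,
          integral_map (by fun_prop) h_logb.aestronglyMeasurable]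
        simp_rw [logb_awgnDensity s hv, add_sub_cancel_left, neg_add]
    _ = diffEntropyBits (gaussianPDFReal 0 1) + diffEntropyBits (gaussianPDFReal 0 v) := by
        rw [integral_add ((h_finite one_ne_zero).comp_fst _) ((h_finite hv).comp_snd _),
          integral_fun_fst (fun x => -Real.logb 2 (gaussianPDFReal 0 1 x)),
          integral_fun_snd (fun z => -Real.logb 2 (gaussianPDFReal 0 v z)),
          integral_neg_logb_gaussianReal one_ne_zero, integral_neg_logb_gaussianReal hv,
          probReal_univ, probReal_univ, one_smul, one_smul]

lemma densityMutualInfo_awgnDensity (hv : v ≠ 0) :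
    densityMutualInfo (awgnDensity s v) = awgnCapacity (s ^ 2 / v) := by
  have hv' : (v : ℝ) ≠ 0 := by exact_mod_cast hv
  have hT : (awgnOutputVariance s v : ℝ) ≠ 0 := by exact_mod_cast awgnOutputVariance_ne_zero s hv
  have h_snr : 1 + s ^ 2 / v = awgnOutputVariance s v / v := by
    rw [coe_awgnOutputVariance, add_div, div_self hv', add_comm]
  rw [densityMutualInfo, margFst_awgnDensity s hv, margSnd_awgnDensity s hv,
    diffEntropyBits_awgnDensity s hv, add_sub_add_left_eq_sub,
    diffEntropyBits_gaussianPDFReal (awgnOutputVariance_ne_zero s hv),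
    diffEntropyBits_gaussianPDFReal hv, awgnCapacity, h_snr, Real.logb_div hT hv',
    Real.logb_mul (by positivity) hT, Real.logb_mul (by positivity) hv']
  ring

end AwgnDensity

/-! ### The first slot -/

lemma measurePreserving_pi_pair {ι Ω : Type*} [Fintype ι] [MeasurableSpace Ω]
    (μ : Measure Ω) [IsProbabilityMeasure μ] {i j : ι} (hij : i ≠ j) :
    MeasurePreserving (fun z : ι → Ω => (z i, z j)) (Measure.pi fun _ => μ) (μ.prod μ) := by
  refine ⟨by fun_prop, ?_⟩
  have h_indep : iIndepFun (fun (i : ι) (z : ι → Ω) => z i) (Measure.pi fun _ => μ) :=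
    iIndepFun_pi (X := fun _ => id) fun _ => aemeasurable_id
  rw [(h_indep.indepFun hij).map_prod_eq_prod_map_map (measurable_pi_apply i).aemeasurable
    (measurable_pi_apply j).aemeasurable, (measurePreserving_eval (fun _ => μ) i).map_eq,
    (measurePreserving_eval (fun _ => μ) j).map_eq]

lemma indepFun_of_measurePreserving_prod {Ω A B : Type*} [MeasurableSpace Ω] [MeasurableSpace A]
    [MeasurableSpace B] {P : Measure Ω} [IsFiniteMeasure P] {p : Measure A} {q : Measure B}
    [IsProbabilityMeasure p] [IsProbabilityMeasure q] {X : Ω → A} {Y : Ω → B}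
    (h : MeasurePreserving (fun ω => (X ω, Y ω)) P (p.prod q)) : IndepFun X Y P := by
  have h_fst : MeasurePreserving X P p := measurePreserving_fst.comp h
  have h_snd : MeasurePreserving Y P q := measurePreserving_snd.comp h
  rw [indepFun_iff_map_prod_eq_prod_map_map h_fst.aemeasurable h_snd.aemeasurable, h.map_eq,
    h_fst.map_eq, h_snd.map_eq]

section FirstSlot

lemma isProbabilityMeasure_codebookLaw (M : Type*) [Fintype M] (n : ℕ) :
    IsProbabilityMeasure (codebookLaw M n) := by
  unfold codebookLaw
  infer_instance

lemma isProbabilityMeasure_firstSlotLaw (α σR2 : ℝ≥0) (k n : ℕ) (M : Type*) [Fintype M] :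
    IsProbabilityMeasure (firstSlotLaw α σR2 k n M) := by
  have := isProbabilityMeasure_codebookLaw M n
  unfold firstSlotLaw
  infer_instance

lemma relayReceived_firstSlot (α : ℝ≥0) (xth : ℝ) {k n : ℕ} (hn : n ≤ k) (x : Fin n → ℝ)
    (g z : Fin k → ℝ) (j : Fin n) :
    relayReceived (firstSlotSource α xth k x) (firstSlotRelay k) g z (Fin.castLE hn j)
      = √(sourcePower α xth 0) * x j + z (Fin.castLE hn j) := by
  simp [relayReceived, firstSlotSource, firstSlotRelay]

lemma firstSlotDensity_eq_awgnDensity (α σR2 : ℝ≥0) (xth : ℝ) :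
    firstSlotDensity α σR2 xth = awgnDensity (√(sourcePower α xth 0)) σR2 := rfl

variable (α σR2 : ℝ≥0) {k n : ℕ} {M : Type*} [Fintype M]

lemma measurePreserving_codeword (w : M) :
    MeasurePreserving (fun c => c w) (codebookLaw M n) (Measure.pi fun _ => gaussianReal 0 1) :=
  measurePreserving_eval (fun _ => Measure.pi fun _ => gaussianReal 0 1) w

lemma measurePreserving_noise_castLE (hn : n ≤ k) :
    MeasurePreserving (fun z j => z.2 (Fin.castLE hn j))
      ((Measure.pi fun _ : Fin k => gaussianReal 0 α).prod (Measure.pi fun _ => gaussianReal 0 σR2))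
      (Measure.pi fun _ => gaussianReal 0 σR2) :=
  (measurePreserving_pi_comp (gaussianReal 0 σR2) (Fin.castLE_injective hn)).comp
    measurePreserving_snd

lemma indepFun_other_codeword_output (s : ℝ) (hn : n ≤ k) {w w' : M} (hw : w' ≠ w) :
    IndepFun (fun ω => ω.1 w') (fun ω j => s * ω.1 w j + ω.2.2 (Fin.castLE hn j))
      (firstSlotLaw α σR2 k n M) := by
  have := isProbabilityMeasure_codebookLaw M n
  have := isProbabilityMeasure_firstSlotLaw α σR2 k n M
  let codewordLaw := Measure.pi fun _ : Fin n => gaussianReal 0 1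
  let channelLaw := (Measure.pi fun _ : Fin k => gaussianReal 0 α).prod
    (Measure.pi fun _ : Fin k => gaussianReal 0 σR2)
  have h_codewords : MeasurePreserving (fun c => (c w', c w)) (codebookLaw M n)
      (codewordLaw.prod codewordLaw) :=
    measurePreserving_pi_pair codewordLaw hw
  have h_triple : MeasurePreserving (fun ω => (ω.1 w', (ω.1 w, ω.2))) (firstSlotLaw α σR2 k n M)
      (codewordLaw.prod (codewordLaw.prod channelLaw)) :=
    (measurePreserving_prodAssoc codewordLaw codewordLaw channelLaw).comp
      (h_codewords.prod (.id channelLaw))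
  have h_indep : IndepFun (fun ω => ω.1 w') (fun ω => (ω.1 w, ω.2)) (firstSlotLaw α σR2 k n M) :=
    indepFun_of_measurePreserving_prod h_triple
  exact h_indep.comp measurable_id (ψ := fun t j => s * t.1 j + t.2.2 (Fin.castLE hn j))
    (by fun_prop)

variable {σR2}

lemma measurePreserving_codeword_output (hσR : σR2 ≠ 0) (s : ℝ) (hn : n ≤ k) (w : M) :
    MeasurePreserving (fun ω j => (ω.1 w j, s * ω.1 w j + ω.2.2 (Fin.castLE hn j)))
      (firstSlotLaw α σR2 k n M) (Measure.pi fun _ => jointLaw (awgnDensity s σR2)) := by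
  have := isProbabilityMeasure_codebookLaw M n
  have := (isPositiveJointDensity_awgnDensity s hσR).isProbabilityMeasure
  have h_symbolwise := (measurePreserving_arrowProdEquivProdArrow ℝ ℝ (Fin n)
    (fun _ => gaussianReal 0 1) (fun _ => gaussianReal 0 σR2)).symm
  have h_channel : MeasurePreserving (fun t : ℝ × ℝ => (t.1, s * t.1 + t.2))
      ((gaussianReal 0 1).prod (gaussianReal 0 σR2)) (jointLaw (awgnDensity s σR2)) :=
    ⟨by fun_prop, (jointLaw_awgnDensity s hσR).symm⟩
  exact (measurePreserving_pi _ _ fun _ => h_channel).comp (h_symbolwise.comp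
    ((measurePreserving_codeword w).prod (measurePreserving_noise_castLE α σR2 hn)))

lemma measureReal_firstSlotError_le (hσR : σR2 ≠ 0) (xth δ : ℝ) (hn : n ≤ k) (w : M) :
    (firstSlotLaw α σR2 k n M).real (firstSlotError α σR2 xth δ hn w) ≤
      (Measure.pi fun _ : Fin n => jointLaw (firstSlotDensity α σR2 xth)).real
          {u | ¬ JointlyTypical (firstSlotDensity α σR2 xth) δ (fun i => (u i).1) fun i => (u i).2}
        + Fintype.card M * 2 ^ (-(n * (awgnCapacity (α * xth ^ 2 / σR2) - 3 * δ))) := by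
  have := isProbabilityMeasure_firstSlotLaw α σR2 k n M
  have h_capacity : densityMutualInfo (firstSlotDensity α σR2 xth)
      = awgnCapacity (α * xth ^ 2 / σR2) := by
    rw [firstSlotDensity_eq_awgnDensity, densityMutualInfo_awgnDensity _ hσR,
      Real.sq_sqrt (sourcePower_nonneg α xth 0), sourcePower_zero]
  have h_codeword (w' : M) : MeasurePreserving (fun ω => ω.1 w') (firstSlotLaw α σR2 k n M)
      (Measure.pi fun _ => withRealDensity volume (margFst (firstSlotDensity α σR2 xth))) := by
    rw [firstSlotDensity_eq_awgnDensity, withRealDensity_margFst_awgnDensity _ hσR]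
    exact (measurePreserving_codeword w').comp measurePreserving_fst
  rw [← h_capacity]
  simp only [firstSlotError, relayReceived_firstSlot]
  exact (isPositiveJointDensity_awgnDensity _ hσR).measureReal_typicalDecoder_ne_le δ
    (measurePreserving_codeword_output α hσR _ hn w) h_codeword (by fun_prop)
    fun w' hw' => indepFun_other_codeword_output α σR2 _ hn hw'

lemma firstSlotErrorProb_le (hσR : σR2 ≠ 0) (xth δ : ℝ) (hn : n ≤ k) [Nonempty M] :
    firstSlotErrorProb α σR2 xth δ hn M ≤
      (Measure.pi fun _ : Fin n => jointLaw (firstSlotDensity α σR2 xth)).real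
          {u | ¬ JointlyTypical (firstSlotDensity α σR2 xth) δ (fun i => (u i).1) fun i => (u i).2}
        + Fintype.card M * 2 ^ (-(n * (awgnCapacity (α * xth ^ 2 / σR2) - 3 * δ))) := by
  have h_card : (0 : ℝ) < Fintype.card M := by exact_mod_cast Fintype.card_pos
  rw [firstSlotErrorProb, div_le_iff₀ h_card, mul_comm, ← nsmul_eq_mul]
  exact Finset.sum_le_card_nsmul _ _ _
    fun w _ => measureReal_firstSlotError_le α hσR xth δ hn w

end FirstSlot

/-! ### Achievability -/

lemma natCeil_natCast_mul_le (k : ℕ) (R : ℝ) : (⌈k * R⌉₊ : ℝ) ≤ k * max R 0 + 1 :=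
  calc (⌈k * R⌉₊ : ℝ) ≤ ⌈k * max R 0⌉₊ := by gcongr; exact le_max_left R 0
    _ ≤ k * max R 0 + 1 := (Nat.ceil_lt_add_one (by positivity)).le

lemma tendsto_two_pow_mul_two_rpow {R p a : ℝ} (ha : 0 ≤ a) (h : max R 0 < p * a) {n : ℕ → ℕ}
    (hn : ∀ k : ℕ, k * p - 1 ≤ n k) :
    Tendsto (fun k : ℕ => (2 : ℝ) ^ ⌈k * R⌉₊ * 2 ^ (-(n k * a))) atTop (𝓝 0) := by
  have h_exponent : Tendsto (fun k : ℕ => k * (max R 0 - p * a) + (1 + a)) atTop atBot :=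
    tendsto_atBot_add_const_right _ _
      (tendsto_natCast_atTop_atTop.atTop_mul_const_of_neg (sub_neg.2 h))
  refine squeeze_zero (fun k => by positivity) (fun k => ?_)
    ((tendsto_rpow_atBot_of_base_gt_one 2 one_lt_two).comp h_exponent)
  rw [← Real.rpow_natCast, ← Real.rpow_add two_pos]
  refine Real.rpow_le_rpow_of_exponent_le one_le_two ?_
  have h_block := mul_le_mul_of_nonneg_right (hn k) ha
  linarith [natCeil_natCast_mul_le k R]

lemma tendsto_blockLength {ν : Measure ℝ} {xth : ℝ} (hp : 0 < transmitProb ν xth) :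
    Tendsto (blockLength ν xth) atTop atTop :=
  tendsto_nat_floor_atTop.comp (tendsto_natCast_atTop_atTop.atTop_mul_const hp)

lemma tendsto_firstSlotErrorProb (α : ℝ≥0) {σR2 : ℝ≥0} (hσR : σR2 ≠ 0) {ν : Measure ℝ}
    [IsProbabilityMeasure ν] {xth R δ : ℝ} (hδ : 0 < δ)
    (hR : max R 0 < transmitProb ν xth * (awgnCapacity (α * xth ^ 2 / σR2) - 3 * δ)) :
    Tendsto (fun k => firstSlotErrorProb α σR2 xth δ (blockLength_le ν xth k) (Message k R))
      atTop (𝓝 0) := by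
  have hp_nonneg : 0 ≤ transmitProb ν xth := measureReal_nonneg
  have h_product : 0 < transmitProb ν xth * (awgnCapacity (α * xth ^ 2 / σR2) - 3 * δ) :=
    (le_max_right R 0).trans_lt hR
  have hp : 0 < transmitProb ν xth := hp_nonneg.lt_of_ne' (left_ne_zero_of_mul h_product.ne')
  have h_gap := pos_of_mul_pos_right h_product hp_nonneg
  have h_atypical :=
    ((isPositiveJointDensity_awgnDensity _ hσR).tendsto_measureReal_not_jointlyTypical
      (hasFiniteEntropies_awgnDensity (√(sourcePower α xth 0)) hσR) hδ).comp
      (tendsto_blockLength hp)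
  have h_confused := tendsto_two_pow_mul_two_rpow h_gap.le hR
    fun k => (Nat.sub_one_lt_floor (k * transmitProb ν xth)).le
  refine squeeze_zero (fun k => ?_) (fun k => ?_) (by simpa using h_atypical.add h_confused)
  · exact div_nonneg (Finset.sum_nonneg fun _ _ => measureReal_nonneg) (Nat.cast_nonneg _)
  · simpa [blockLength, firstSlotDensity_eq_awgnDensity] using
      firstSlotErrorProb_le α hσR xth δ (blockLength_le ν xth k) (M := Message k R)

theorem lemma1 (α σR2 σD2 PS PR : ℝ≥0)
    (hα : 0 < α) (hσR : 0 < σR2) (hσD : 0 < σD2) (hPS : 0 < PS) (hPR : 0 < PR)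
    (ν : Measure ℝ) [IsProbabilityMeasure ν]
    (hν : IsOptimalRelayInput α σR2 σD2 PS PR ν)
    (xth : ℝ) (hxth : 0 < xth) (hpow : ∫ x, sourcePower α xth x ∂ν = (PS : ℝ))
    (R ε : ℝ) (hε : 0 < ε) (hR : R = (relayCapacity α σR2 σD2 PS PR).toReal - ε) :
    relayCapacity α σR2 σD2 PS PR ≠ ∞ ∧
    IsGreatest
      {I : ℝ≥0∞ | ∃ p : Measure ℝ, IsProbabilityMeasure p ∧
        ∫⁻ s, ENNReal.ofReal (s ^ 2) ∂p ≤ ENNReal.ofReal (sourcePower α xth 0) ∧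
        I = sourceRelayInfoAt α σR2 0 p}
      (ENNReal.ofReal (1 / 2 * Real.logb 2 (1 + α * xth ^ 2 / σR2))) ∧
    R < 1 / 2 * Real.logb 2 (1 + α * xth ^ 2 / σR2) * transmitProb ν xth ∧
    ∃ δ₀ : ℝ, 0 < δ₀ ∧ ∀ δ : ℝ, 0 < δ → δ < δ₀ →
      Tendsto
        (fun k : ℕ =>
          firstSlotErrorProb α σR2 xth δ (blockLength_le ν xth k) (Message k R))
        atTop (𝓝 0) := by
  set I := awgnCapacity (α * xth ^ 2 / σR2)
  set p := transmitProb ν xth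
  have hp : 0 < p := transmitProb_pos hPS ν hxth.le hpow
  have hI_pos : 0 < I := awgnCapacity_pos (by positivity)
  have h_converse : R < I * p := by linarith [toReal_relayCapacity_le hσR ν hν hxth.le hpow]
  refine ⟨relayCapacity_ne_top α σR2 PS PR hσD, isGreatest_sourceRelayInfoAt_zero α hσR xth,
    h_converse, (I - max R 0 / p) / 3, ?_, fun δ hδ hδ₀ => ?_⟩
  · have h_rate : max R 0 / p < I := (div_lt_iff₀ hp).2 (max_lt h_converse (mul_pos hI_pos hp))
    linarith
  · have h_rate : max R 0 < p * (I - 3 * δ) := (div_lt_iff₀' hp).1 (by linarith)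
    exact tendsto_firstSlotErrorProb α hσR.ne' hδ h_rate
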